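/- Let $F'/F$ be a field extension. An $F$-linear abelian category $\mathcal A$ is called $F$-finite if every object has finite length and every endomorphism algebra is finite-dimensional over $F$. For such $\mathcal A$, let $\mathrm{Ind}\,\mathcal A$ be its category of ind-objects (filtered systems indexed by small categories). An $F'$-module in $\mathrm{Ind}\,\mathcal A$ is an ind-object $X$ with an $F$-linear ring homomorphism $F'\to\mathrm{End}(X)$; homomorphisms of $F'$-modules are the morphisms of ind-objects that commute with the actions. The scalar extension $\mathcal A\otimes_FF'$ is the full subcategory, of the category of $F'$-modules in $\mathrm{Ind}\,\mathcal A$, consisting of the $F'$-modules of finite length. For $X\in\mathcal A$ let $t(X)=F'\otimes_FX$, the ind-object representing $Y\mapsto\mathrm{Hom}_F(F',\mathrm{Hom}(X,Y))$, with the action of $F'$ on itself by multiplication. An abelian tensor category over a field $K$ is an abelian category with a symmetric monoidal structure whose tensor product $\otimes$ is biadditive and right exact in each variable, together with a ring isomorphism $K\to\mathrm{End}(\mathbf 1)$; the category is then $K$-linear and $\otimes$ is $K$-bilinear. A tensor functor is a functor $V$ with isomorphisms $\mathbf 1\cong V(\mathbf 1)$ and $V(X)\otimes V(Y)\cong V(X\otimes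 Y)$, natural in $X$ and $Y$, compatible with the associativity, commutativity and unit constraints. Theorem. Let $(\mathcal T,\otimes)$ be an $F$-finite abelian tensor category over $F$. Then $t(X)$ has finite length for every object $X$ of $\mathcal T$, so that $t$ is a functor $\mathcal T\to\mathcal T\otimes_FF'$, and there are a tensor product $\otimes'$, a unit object and associativity, commutativity and unit constraints on $\mathcal T\otimes_FF'$, and tensor constraints on $t$, such that: (a) $(\mathcal T\otimes_FF',\otimes')$, with the $F'$-linear structure given by the actions of $F'$, is an abelian tensor category over $F'$; in particular $F'\to\mathrm{End}(\mathbf 1')$, $c\mapsto c\cdot\mathrm{id}$, is an isomorphism for its unit object $\mathbf 1'$. (b) $t:\mathcal T\to\mathcal T\otimes_FF'$ is a tensor functor; in particular $\mathbf 1'\cong t(\mathbf 1)$ and $\mu_{X,Y}:t(X)\otimes' t(Y)\cong t(X\otimes Y)$. (c) $\otimes'$ is the extension of $\otimes$ in the sense of the universal property of scalar extension for bilinear functors: for every functor $M:(\mathcal T\otimes_FF')\times(\mathcal T\otimes_FF')\to\mathcal T\otimes_FF'$ that is $F'$-linear and right exact in each variable and every isomorphism of functors $\alpha:t\circ\otimes\Rightarrow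 M\circ(t\times t)$, there is a unique isomorphism of functors $e:\otimes'\Rightarrow M$ such that $e_{(t(X),t(Y))}=\alpha_{(X,Y)}\circ\mu_{X,Y}$ for all objects $X,Y$ of $\mathcal T$. -/

import Mathlib

open CategoryTheory Limits MonoidalCategory

universe w v u

namespace ScalarExtension

/-! ### The category of ind-objects is `F`-linear

`Ind T` is Mathlib's category of ind-objects of `T`. The abelian group structure on its
morphisms is obtained from the fact that ind-objects are left exact presheaves of sets, hence,
in a unique way, left exact presheaves of abelian groups; a scalar `c` acts on the ind-object `P`
through the endomorphisms `c • 𝟙 Z` of the objects `Z` of `T`. -/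

section IndLinear

variable {T : Type u} [Category.{v} T]

theorem preservesFiniteLimits_of_isIndObject {P : Tᵒᵖ ⥤ Type v} (hP : IsIndObject P) :
    PreservesFiniteLimits P := by
  obtain ⟨⟨Q⟩⟩ := hP
  let G : Q.I ⥤ Tᵒᵖ ⥤ Type v := Q.F ⋙ yoneda
  have h1 : PreservesFiniteLimits G.flip := ⟨fun J _ _ => by
    refine preservesLimitsOfShape_of_evaluation _ _ fun i => ?_
    exact inferInstanceAs (PreservesLimitsOfShape J (yoneda.obj (Q.F.obj i)))⟩
  have h2 : PreservesFiniteLimits (G.flip ⋙ colim) := comp_preservesFiniteLimits _ _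
  exact ⟨fun J _ _ => preservesLimitsOfShape_of_natIso
    ((colimitIsoFlipCompColim G).symm ≪≫
      (colimit.isColimit G).coconePointUniqueUpToIso Q.isColimit)⟩

variable (T) in
/-- Ind-objects as left exact presheaves of sets. -/
noncomputable def indToLeftExact : Ind T ⥤ (Tᵒᵖ ⥤ₗ Type v) :=
  ObjectProperty.lift _ (Ind.inclusion T) fun X =>
    preservesFiniteLimits_of_isIndObject (Ind.isIndObject_inclusion_obj X)

variable (T) in
/-- The functor `indToLeftExact` is fully faithful. -/
noncomputable def indToLeftExactFullyFaithful : (indToLeftExact T).FullyFaithful :=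
  Functor.FullyFaithful.ofCompFaithful (G := ObjectProperty.ι _)
    (show (indToLeftExact T ⋙ ObjectProperty.ι _).FullyFaithful from
      Ind.inclusion.fullyFaithful)

variable [Abelian T]

theorem hasFiniteBiproducts_op : HasFiniteBiproducts Tᵒᵖ :=
  HasFiniteBiproducts.of_hasFiniteCoproducts

attribute [local instance] hasFiniteBiproducts_op

variable (T) in
/-- Ind-objects as left exact presheaves of abelian groups. -/
noncomputable def indToAb : Ind T ⥤ (Tᵒᵖ ⥤ AddCommGrpCat.{v}) :=
  (indToLeftExact T ⋙ (AddCommGrpCat.leftExactFunctorForgetEquivalence Tᵒᵖ).inverse) ⋙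
    ObjectProperty.ι _

variable (T) in
/-- The functor `indToAb` is fully faithful. -/
noncomputable def indToAbFullyFaithful : (indToAb T).FullyFaithful :=
  ((indToLeftExactFullyFaithful T).comp
    (AddCommGrpCat.leftExactFunctorForgetEquivalence Tᵒᵖ).fullyFaithfulInverse).comp
      (ObjectProperty.fullyFaithfulι _)

noncomputable instance indPreadditive : Preadditive (Ind T) :=
  .ofFullyFaithful (indToAbFullyFaithful T)

theorem indToAb_additive : (indToAb T).Additive :=
  (indToAbFullyFaithful T).additive_ofFullyFaithful

theorem indToAb_obj_additive (X : Ind T) : ((indToAb T).obj X).Additive := by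
  have : PreservesFiniteLimits ((indToAb T).obj X) :=
    ((indToLeftExact T ⋙
      (AddCommGrpCat.leftExactFunctorForgetEquivalence Tᵒᵖ).inverse).obj X).property
  exact Functor.additive_of_preserves_binary_products _

variable (F : Type w) [Field F] [Linear F T]

/-- The endomorphism of the ind-object `X` by which the scalar `c` acts. -/
noncomputable def indScalar (c : F) (X : Ind T) : X ⟶ X :=
  (indToAbFullyFaithful T).preimage
    { app := fun Z => ((indToAb T).obj X).map (c • 𝟙 Z.unop).op
      naturality := fun Z W f => by
        rw [← Functor.map_comp, ← Functor.map_comp]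
        congr 1
        apply Quiver.Hom.unop_inj
        simp }

theorem indToAb_map_indScalar (c : F) (X : Ind T) (Z : Tᵒᵖ) :
    ((indToAb T).map (indScalar F c X)).app Z = ((indToAb T).obj X).map (c • 𝟙 Z.unop).op := by
  simp [indScalar]

theorem indHom_ext {X Y : Ind T} {f g : X ⟶ Y}
    (h : ∀ Z, ((indToAb T).map f).app Z = ((indToAb T).map g).app Z) : f = g :=
  (indToAbFullyFaithful T).map_injective (by ext1; exact funext h)

theorem indScalar_naturality (c : F) {X Y : Ind T} (f : X ⟶ Y) :
    f ≫ indScalar F c Y = indScalar F c X ≫ f :=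
  indHom_ext fun Z => by simp [indToAb_map_indScalar]

theorem indScalar_one (X : Ind T) : indScalar F 1 X = 𝟙 X :=
  indHom_ext fun Z => by simp [indToAb_map_indScalar]

theorem indScalar_mul (a b : F) (X : Ind T) :
    indScalar F (a * b) X = indScalar F a X ≫ indScalar F b X :=
  indHom_ext fun Z => by
    rw [Functor.map_comp, NatTrans.comp_app, indToAb_map_indScalar, indToAb_map_indScalar,
      indToAb_map_indScalar, ← Functor.map_comp, ← op_comp]
    simp [smul_smul]

theorem indScalar_zero (X : Ind T) : indScalar F 0 X = 0 := by
  have := indToAb_additive (T := T)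
  have := indToAb_obj_additive X
  exact indHom_ext fun Z => by simp [indToAb_map_indScalar]

theorem indScalar_add (a b : F) (X : Ind T) :
    indScalar F (a + b) X = indScalar F a X + indScalar F b X := by
  have := indToAb_additive (T := T)
  have := indToAb_obj_additive X
  exact indHom_ext fun Z => by
    simp [indToAb_map_indScalar, add_smul, Functor.map_add]

variable (T) in
/-- The ring homomorphism from the scalars to the centre of the category of ind-objects. -/
noncomputable def indCenter : F →+* CatCenter (Ind T) where
  toFun c :=
    { app := indScalar F c
      naturality := fun _ _ f => indScalar_naturality F c f }
  map_one' := NatTrans.ext (funext fun X => indScalar_one F X)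
  map_mul' a b := NatTrans.ext (funext fun X => by
    exact (congrArg (indScalar F · X) (mul_comm a b)).trans (indScalar_mul F b a X))
  map_zero' := NatTrans.ext (funext fun X => indScalar_zero F X)
  map_add' a b := NatTrans.ext (funext fun X => indScalar_add F a b X)

noncomputable instance indLinear : Linear F (Ind T) :=
  Linear.ofRingMorphism (indCenter T F)

end IndLinear

/-! ### Modules in the category of ind-objects -/

section Modules

variable (F : Type w) (F' : Type v) [Field F] [Field F'] [Algebra F F']
variable (T : Type u) [Category.{v} T] [Abelian T] [Linear F T]

/-- An `F'`-module in `Ind T`: an ind-object together with an `F`-linear ring homomorphism from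
`F'` to its endomorphism ring. -/
structure IndModule where
  /-- the underlying ind-object -/
  obj : Ind T
  /-- the action of `F'` -/
  act : F' →ₐ[F] End obj

namespace IndModule

variable {F F' T}

/-- The endomorphism by which `a : F'` acts on the ind-object underlying an `F'`-module. -/
noncomputable def smulHom (X : IndModule F F' T) (a : F') : X.obj ⟶ X.obj := X.act a

theorem smulHom_one (X : IndModule F F' T) : X.smulHom 1 = 𝟙 _ := map_one X.act

theorem smulHom_zero (X : IndModule F F' T) : X.smulHom 0 = 0 := map_zero X.act

theorem smulHom_add (X : IndModule F F' T) (a b : F') :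
    X.smulHom (a + b) = X.smulHom a + X.smulHom b := map_add X.act a b

theorem smulHom_mul (X : IndModule F F' T) (a b : F') :
    X.smulHom (a * b) = X.smulHom b ≫ X.smulHom a := map_mul X.act a b

theorem smulHom_comm (X : IndModule F F' T) (a b : F') :
    X.smulHom a ≫ X.smulHom b = X.smulHom b ≫ X.smulHom a := by
  rw [← smulHom_mul, ← smulHom_mul, mul_comm]

/-- A homomorphism of `F'`-modules in `Ind T`. -/
@[ext]
structure Hom (X Y : IndModule F F' T) where
  /-- the underlying morphism of ind-objects -/
  hom : X.obj ⟶ Y.obj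
  comm : ∀ a : F', X.smulHom a ≫ hom = hom ≫ Y.smulHom a

noncomputable instance : Category (IndModule F F' T) where
  Hom X Y := Hom X Y
  id X := { hom := 𝟙 X.obj, comm := fun a => by simp }
  comp f g :=
    { hom := f.hom ≫ g.hom
      comm := fun a => by rw [← Category.assoc, f.comm, Category.assoc, g.comm, Category.assoc] }
  id_comp f := Hom.ext (Category.id_comp f.hom)
  comp_id f := Hom.ext (Category.comp_id f.hom)
  assoc f g h := Hom.ext (Category.assoc f.hom g.hom h.hom)

@[ext]
theorem hom_ext {X Y : IndModule F F' T} {f g : X ⟶ Y} (h : f.hom = g.hom) : f = g := Hom.ext h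

@[simp]
theorem id_hom (X : IndModule F F' T) : Hom.hom (𝟙 X) = 𝟙 X.obj := rfl

@[simp]
theorem comp_hom {X Y Z : IndModule F F' T} (f : X ⟶ Y) (g : Y ⟶ Z) :
    (f ≫ g).hom = f.hom ≫ g.hom := rfl

variable {X Y : IndModule F F' T}

noncomputable instance : Zero (X ⟶ Y) := ⟨{ hom := 0, comm := fun a => by simp }⟩

noncomputable instance : Add (X ⟶ Y) := ⟨fun f g =>
  { hom := f.hom + g.hom
    comm := fun a => by rw [Preadditive.comp_add, Preadditive.add_comp, f.comm, g.comm] }⟩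

noncomputable instance : Neg (X ⟶ Y) := ⟨fun f =>
  { hom := -f.hom
    comm := fun a => by rw [Preadditive.comp_neg, Preadditive.neg_comp, f.comm] }⟩

noncomputable instance : Sub (X ⟶ Y) := ⟨fun f g =>
  { hom := f.hom - g.hom
    comm := fun a => by rw [Preadditive.comp_sub, Preadditive.sub_comp, f.comm, g.comm] }⟩

noncomputable instance : SMul ℕ (X ⟶ Y) := ⟨fun n f =>
  { hom := n • f.hom
    comm := fun a => by rw [Preadditive.comp_nsmul, Preadditive.nsmul_comp, f.comm] }⟩

noncomputable instance : SMul ℤ (X ⟶ Y) := ⟨fun n f =>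
  { hom := n • f.hom
    comm := fun a => by rw [Preadditive.comp_zsmul, Preadditive.zsmul_comp, f.comm] }⟩

/-- `F'` acts on morphisms through its action on the target (equivalently, on the source). -/
noncomputable instance : SMul F' (X ⟶ Y) := ⟨fun c f =>
  { hom := f.hom ≫ Y.smulHom c
    comm := fun a => by
      rw [← Category.assoc, f.comm, Category.assoc, Category.assoc, smulHom_comm] }⟩

noncomputable instance : AddCommGroup (X ⟶ Y) :=
  Function.Injective.addCommGroup (fun f : X ⟶ Y => f.hom) (fun _ _ h => hom_ext h) rfl
    (fun _ _ => rfl) (fun _ => rfl) (fun _ _ => rfl) (fun _ _ => rfl) (fun _ _ => rfl)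

@[simp]
theorem zero_hom : Hom.hom (0 : X ⟶ Y) = 0 := rfl

@[simp]
theorem add_hom (f g : X ⟶ Y) : (f + g).hom = f.hom + g.hom := rfl

@[simp]
theorem smul_hom (c : F') (f : X ⟶ Y) : (c • f).hom = f.hom ≫ Y.smulHom c := rfl

noncomputable instance : Preadditive (IndModule F F' T) where
  add_comp _ _ _ _ _ _ := by ext; simp
  comp_add _ _ _ _ _ _ := by ext; simp

noncomputable instance : Module F' (X ⟶ Y) where
  one_smul f := by ext; simp [smulHom_one]
  mul_smul a b f := by ext; simp [smulHom_mul]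
  smul_zero a := by ext; simp
  zero_smul f := by ext; simp [smulHom_zero]
  smul_add a f g := by ext; simp
  add_smul a b f := by ext; simp [smulHom_add]

noncomputable instance : Linear F' (IndModule F F' T) where
  smul_comp _ _ _ c f g := by ext; simp [g.comm]
  comp_smul _ _ _ f c g := by ext; simp

end IndModule

end Modules

/-! ### The external tensor product and the functor `t` -/

section ExternalTensor

variable (F : Type w) [Field F] {T : Type u} [Category.{v} T] [Abelian T] [Linear F T]
variable (M N K : Type v) [AddCommGroup M] [Module F M] [AddCommGroup N] [Module F N]
  [AddCommGroup K] [Module F K]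

/-- The external tensor product `M ⊗_F X` of an `F`-vector space and an ind-object, a direct sum
of `dim M` copies of `X`. By `extHomEquiv`, it represents `Y ↦ Hom_F(M, Hom(X, Y))`. -/
noncomputable def extTensor (X : Ind T) : Ind T :=
  ∐ fun _ : Module.Free.ChooseBasisIndex F M => X

variable {M N K}

/-- The morphism `m ⊗ - : X ⟶ M ⊗_F X`, which is `F`-linear in `m`. -/
noncomputable def extIns (X : Ind T) : M →ₗ[F] (X ⟶ extTensor F M X) :=
  (Module.Free.chooseBasis F M).constr F fun b =>
    Sigma.ι (fun _ : Module.Free.ChooseBasisIndex F M => X) b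

/-- The morphism `M ⊗_F X ⟶ Y` induced by an `F`-linear map `M → Hom(X, Y)`. -/
noncomputable def extDesc {X Y : Ind T} (g : M →ₗ[F] (X ⟶ Y)) : extTensor F M X ⟶ Y :=
  Sigma.desc fun b => g (Module.Free.chooseBasis F M b)

theorem extIns_basis (X : Ind T) (b : Module.Free.ChooseBasisIndex F M) :
    extIns F X (Module.Free.chooseBasis F M b) =
      Sigma.ι (fun _ : Module.Free.ChooseBasisIndex F M => X) b :=
  Module.Basis.constr_basis _ _ _ _

@[simp]
theorem extIns_desc {X Y : Ind T} (g : M →ₗ[F] (X ⟶ Y)) (m : M) :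
    extIns F X m ≫ extDesc F g = g m := by
  have h : Linear.rightComp F X (extDesc F g) ∘ₗ extIns F X = g :=
    (Module.Free.chooseBasis F M).ext fun b => by
      rw [LinearMap.comp_apply, extIns_basis]
      exact Sigma.ι_desc (fun b => g (Module.Free.chooseBasis F M b)) b
  exact LinearMap.congr_fun h m

theorem ext_hom_ext {X Y : Ind T} {f g : extTensor F M X ⟶ Y}
    (h : ∀ m : M, extIns F X m ≫ f = extIns F X m ≫ g) : f = g :=
  Sigma.hom_ext _ _ fun b => by
    have := h (Module.Free.chooseBasis F M b)
    rwa [extIns_basis] at this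

/-- The universal property of the external tensor product. -/
noncomputable def extHomEquiv (X Y : Ind T) :
    (extTensor F M X ⟶ Y) ≃ₗ[F] (M →ₗ[F] (X ⟶ Y)) where
  toFun f := Linear.rightComp F X f ∘ₗ extIns F X
  invFun g := extDesc F g
  map_add' f g := by ext; simp
  map_smul' c f := by ext; simp
  left_inv f := ext_hom_ext F fun m => by simp
  right_inv g := by ext; simp

/-- The external tensor product of a linear map and a morphism of ind-objects. -/
noncomputable def extMap (φ : M →ₗ[F] N) {X Y : Ind T} (f : X ⟶ Y) :
    extTensor F M X ⟶ extTensor F N Y :=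
  extDesc F (Linear.leftComp F (extTensor F N Y) f ∘ₗ extIns F Y ∘ₗ φ)

@[simp]
theorem extIns_map (φ : M →ₗ[F] N) {X Y : Ind T} (f : X ⟶ Y) (m : M) :
    extIns F X m ≫ extMap F φ f = f ≫ extIns F Y (φ m) := by
  simp [extMap]

theorem extMap_id (X : Ind T) : extMap F (LinearMap.id : M →ₗ[F] M) (𝟙 X) = 𝟙 _ :=
  ext_hom_ext F fun m => by simp

theorem extMap_comp (φ : M →ₗ[F] N) (ψ : N →ₗ[F] K) {X Y Z : Ind T} (f : X ⟶ Y) (g : Y ⟶ Z) :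
    extMap F (ψ ∘ₗ φ) (f ≫ g) = extMap F φ f ≫ extMap F ψ g :=
  ext_hom_ext F fun m => by
    rw [← Category.assoc (extIns F X m), extIns_map, extIns_map, Category.assoc,
      Category.assoc, extIns_map, LinearMap.comp_apply]

theorem extMap_add (φ ψ : M →ₗ[F] N) {X Y : Ind T} (f : X ⟶ Y) :
    extMap F (φ + ψ) f = extMap F φ f + extMap F ψ f :=
  ext_hom_ext F fun m => by simp

theorem extMap_smul (c : F) (φ : M →ₗ[F] N) {X Y : Ind T} (f : X ⟶ Y) :
    extMap F (c • φ) f = c • extMap F φ f :=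
  ext_hom_ext F fun m => by simp

variable (F' : Type v) [Field F'] [Algebra F F']

/-- The `F'`-module `(F' ⊗_F X, μ ⊗ id)` in `Ind T`, where `μ` is the multiplication of `F'`. -/
noncomputable def indScalarExt (X : Ind T) : IndModule F F' T where
  obj := extTensor F F' X
  act := AlgHom.ofLinearMap
    { toFun := fun a => (extMap F (LinearMap.mulLeft F a) (𝟙 X) : extTensor F F' X ⟶ _)
      map_add' := fun a b => by
        rw [← extMap_add]
        congr 1
        exact map_add (LinearMap.mul F F') a b
      map_smul' := fun c a => by
        rw [RingHom.id_apply]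
        refine Eq.trans ?_ (extMap_smul F c (LinearMap.mulLeft F a) (𝟙 X))
        congr 1
        exact map_smul (LinearMap.mul F F') c a }
    (ext_hom_ext F fun m => by
      change extIns F X m ≫ extMap F (LinearMap.mulLeft F 1) (𝟙 X) = extIns F X m ≫ 𝟙 _
      simp)
    (fun a b => ext_hom_ext F fun m => by
      change extIns F X m ≫ extMap F (LinearMap.mulLeft F (a * b)) (𝟙 X) =
        extIns F X m ≫ extMap F (LinearMap.mulLeft F b) (𝟙 X) ≫
          extMap F (LinearMap.mulLeft F a) (𝟙 X)
      rw [← extMap_comp]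
      simp)

theorem indScalarExt_smulHom (X : Ind T) (a : F') :
    (indScalarExt F F' X).smulHom a = extMap F (LinearMap.mulLeft F a) (𝟙 X) := rfl

variable (T) in
/-- The functor `t : T ⥤ (Ind T)_{F'}`, `X ↦ (F' ⊗_F X, μ ⊗ id)`. -/
noncomputable def scalarExtFunctor : T ⥤ IndModule F F' T where
  obj X := indScalarExt F F' (Ind.yoneda.obj X)
  map f :=
    { hom := extMap F LinearMap.id (Ind.yoneda.map f)
      comm := fun a => by
        rw [indScalarExt_smulHom, indScalarExt_smulHom]
        refine (extMap_comp F _ _ _ _).symm.trans (Eq.trans ?_ (extMap_comp F _ _ _ _))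
        simp }
  map_id X := by
    ext
    exact (congrArg _ (Ind.yoneda.map_id X)).trans (extMap_id F _)
  map_comp f g := by
    ext
    exact (congrArg _ (Ind.yoneda.map_comp f g)).trans
      (extMap_comp F LinearMap.id LinearMap.id _ _)

end ExternalTensor

/-! ### The scalar extension of a category -/

/-- An object of a category has finite length if its subobjects satisfy both chain conditions. -/
def HasFiniteLength (C : Type u) [Category.{v} C] : ObjectProperty C :=
  fun X => IsArtinianObject X ∧ IsNoetherianObject X

/-- `F`-finiteness: all objects have finite length and all endomorphism algebras are
finite-dimensional. -/
class FFinite (F : Type w) [Field F] (C : Type u) [Category.{v} C] [Preadditive C] [Linear F C] :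
    Prop where
  hasFiniteLength : ∀ X : C, HasFiniteLength C X
  finite_end : ∀ X : C, FiniteDimensional F (End X)

section ScalarExt

variable (F : Type w) (F' : Type v) [Field F] [Field F'] [Algebra F F']
variable (T : Type u) [Category.{v} T] [Abelian T] [Linear F T]

/-- The scalar extension `T ⊗_F F'`: the full subcategory of the category of `F'`-modules in
`Ind T` that consists of the `F'`-modules of finite length. -/
abbrev ScalarExt : Type (max u (v + 1)) :=
  (HasFiniteLength (IndModule F F' T)).FullSubcategory

variable {F F' T} in
/-- The functor `t : T ⥤ T ⊗_F F'`; it exists as soon as the objects `t(X)` have finite length. -/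
noncomputable abbrev toScalarExt
    (h : ∀ X : T, HasFiniteLength (IndModule F F' T) ((scalarExtFunctor F T F').obj X)) :
    T ⥤ ScalarExt F F' T :=
  ObjectProperty.lift _ (scalarExtFunctor F T F') h

end ScalarExt

/-! ### Abelian tensor categories -/

/-- A bifunctor that is right exact and `R`-linear in each argument. -/
structure IsRightExactBilinear (R : Type w) [Field R] {C : Type u} [Category.{v} C]
    [Preadditive C] [Linear R C] (M : C × C ⥤ C) : Prop where
  additive_left (Y : C) : (Prod.sectL C Y ⋙ M).Additive
  additive_right (X : C) : (Prod.sectR X C ⋙ M).Additive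
  linear_left (Y : C) : (Prod.sectL C Y ⋙ M).Linear R
  linear_right (X : C) : (Prod.sectR X C ⋙ M).Linear R
  rightExact_left (Y : C) : PreservesFiniteColimits (Prod.sectL C Y ⋙ M)
  rightExact_right (X : C) : PreservesFiniteColimits (Prod.sectR X C ⋙ M)

/-- Abelian tensor categories over a field `R`: abelian symmetric monoidal categories with right
exact biadditive tensor product for which the action of `R` on the unit object is an isomorphism
`R ≅ End(𝟙)`. The `R`-linear structure of the category is the one that this isomorphism induces;
this is what the bilinearity of the tensor product says. -/
class AbelianTensorCategory (R : Type w) [Field R] (C : Type u) [Category.{v} C]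
    [Preadditive C] [Linear R C] [MonoidalCategory C] [SymmetricCategory C] : Prop where
  abelian : ∃ A : Abelian C, A.toPreadditive = ‹Preadditive C›
  bilinear : IsRightExactBilinear R (tensor C)
  unit : Function.Bijective (algebraMap R (End (𝟙_ C)))

end ScalarExtension

open ScalarExtension

/-! Write C for T ⊗ F'. The proof isolates four properties of t : T ⥤ C, collected in
`IsScalarExtension`, and works only with these afterwards: t is right exact and F-linear; Hom(tW,
tX) is F' ⊗ Hom(W, X); every object of C is a quotient of some tW; and a morphism tW ⟶ Y lifts
through an epimorphism X ⟶ Y after restriction along t(p) for some epimorphism p : V ⟶ W of T.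

The second property holds because F' ⊗ X is a coproduct of copies of X and a morphism from a
representable ind-object to a coproduct meets only finitely many summands (`homBasis`). Finite
length of tX reduces, by right exactness of t, to simple X. There a subobject of tX is determined by
the endomorphisms of tX that factor through it, and these form a subspace of the finite-dimensional
F'-space F' ⊗ End(X) (`hasFiniteLength_of_simple`). The last two properties are noetherian arguments
with a maximal image (`exists_epi_scalarExt`, `exists_lift_scalarExt`).

Let G : T ⥤ E be right exact and F-linear. Its extension H to C must send X = coker(tR ⟶ tP) to the
cokernel of the induced morphism G(R) ⟶ G(P). Presentations need not be compared if H(X) is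
described by what it represents: morphisms H(X) ⟶ Y are natural families of F'-linear maps Hom(tW,
X) → Hom(G(W), Y) (`Family.IsUniversal`). For G = t ⋙ H the maps f ↦ H(f) form such a universal
family, so natural transformations extend as well, and uniquely (`exists_natTrans`, `natTrans_ext`).
Functors of two or three variables are treated one variable at a time, with values in functor
categories.

So ⊗ extends to C, and so do the associativity, unit and commutativity isomorphisms, whose values on
the objects tW are forced by compatibility with μ. A coherence identity holds on the objects tW by
transport from T, and then everywhere, because these objects cover C and the new tensor product
preserves epimorphisms. Finally End(t(𝟙)) = F' ⊗ End(𝟙) = F', and (c) is the extension of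
transformations of bifunctors. -/

namespace ScalarExtension

/-! ### The abelian category of ind-objects and compactness of representables -/

section IndAbelian

variable {T : Type u} [Category.{v} T]

/-- A morphism from a representable ind-object to a filtered colimit factors through a stage. -/
theorem exists_factor_of_isColimit {J : Type v} [SmallCategory J] [IsFiltered J] {K : J ⥤ Ind T}
    {c : Cocone K} (hc : IsColimit c) {W : T} (f : Ind.yoneda.obj W ⟶ c.pt) :
    ∃ (j : J) (g : Ind.yoneda.obj W ⟶ K.obj j), g ≫ c.ι.app j = f := by
  -- Evaluation of ind-objects at `W` preserves filtered colimits, so the Yoneda element of `f`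
  -- comes from some stage.
  let E := Ind.inclusion T ⋙ (evaluation _ _).obj (Opposite.op W)
  let θ := (Ind.yonedaCompInclusion (C := T)).app W
  have hc' : IsColimit (E.mapCocone c) := isColimitOfPreserves E hc
  obtain ⟨j, x, hx⟩ := Types.jointly_surjective_of_isColimit hc'
    (yonedaEquiv (θ.inv ≫ (Ind.inclusion T).map f))
  refine ⟨j, (Ind.inclusion T).preimage (θ.hom ≫ yonedaEquiv.symm x), ?_⟩
  apply (Ind.inclusion T).map_injective
  rw [Functor.map_comp, Functor.map_preimage, ← cancel_epi θ.inv, Category.assoc,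
    Iso.inv_hom_id_assoc, ← yonedaEquiv.injective.eq_iff, ← hx, yonedaEquiv_comp,
    Equiv.apply_symm_apply]
  rfl

theorem ind_hom_ext {X Y : Ind T} {f g : X ⟶ Y}
    (h : ∀ (W : T) (i : Ind.yoneda.obj W ⟶ X), i ≫ f = i ≫ g) : f = g :=
  Ind.isSeparating_range_yoneda _ _ (by rintro _ ⟨W⟩ i; exact h W i)

variable [Abelian T]

instance indHasFiniteBiproducts : HasFiniteBiproducts (Ind T) :=
  HasFiniteBiproducts.of_hasFiniteCoproducts

/-- Every morphism of ind-objects is isomorphic to a filtered colimit of a morphism of diagrams in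
`T`. Since `Ind.lim I` preserves kernels and cokernels, the comparison is the image of the one for
diagrams, which is an isomorphism. -/
instance isIso_coimageImageComparison_ind {X Y : Ind T} (f : X ⟶ Y) :
    IsIso (Abelian.coimageImageComparison f) := by
  obtain ⟨I, _, _, F, G, ϕ, ⟨i⟩⟩ := Ind.exists_nonempty_arrow_mk_iso_ind_lim (f := f)
  let i' : Arrow.mk (Abelian.coimageImageComparison f) ≅
      Arrow.mk (Abelian.coimageImageComparison ((Ind.lim I).map ϕ)) :=
    Abelian.coimageImageComparisonFunctor.mapIso i
  have := Iso.isIso_hom i'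
  rw [Arrow.isIso_iff_isIso_of_isIso i'.hom,
    Arrow.isIso_iff_isIso_of_isIso
      (Abelian.PreservesCoimageImageComparison.iso (Ind.lim I) ϕ).inv]
  infer_instance

noncomputable instance (priority := 100) indAbelian : Abelian (Ind T) :=
  .ofCoimageImageComparisonIsIso

instance : (Ind.yoneda (C := T)).Additive :=
  Functor.additive_of_preserves_binary_products _

/-- A morphism from a representable ind-object to a coproduct factors through a finite
subcoproduct. -/
theorem exists_finset_factor {I : Type v} (X : I → Ind T) (W : T)
    (f : Ind.yoneda.obj W ⟶ ∐ X) :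
    ∃ (s : Finset (Discrete I)) (g : Ind.yoneda.obj W ⟶
      ∐ fun i : s => X i.1.as), g ≫ Sigma.desc (fun i : s => Sigma.ι X i.1.as) = f :=
  exists_factor_of_isColimit
    (CoproductsFromFiniteFiltered.isColimitFiniteSubproductsCocone X) f

variable (F : Type w) [Field F] [Linear F T]

theorem inclusion_map_indScalar (c : F) (X : Ind T) (Z : Tᵒᵖ) :
    ((Ind.inclusion T).map (indScalar F c X)).app Z =
      ((Ind.inclusion T).obj X).map (c • 𝟙 Z.unop).op :=
  congrArg (forget AddCommGrpCat).map (indToAb_map_indScalar F c X Z)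

/-- By bilinearity of composition in `T`, precomposing with `c • 𝟙 Z` and postcomposing with `c • 𝟙
X` agree on Hom(Z, X). This is what makes the Yoneda embedding `F`-linear. -/
theorem indScalar_yoneda (c : F) (X : T) :
    indScalar F c (Ind.yoneda.obj X) = Ind.yoneda.map (c • 𝟙 X) := by
  apply (Ind.inclusion T).map_injective
  let θ := Ind.yonedaCompInclusion (C := T)
  have h := θ.hom.naturality (c • 𝟙 X)
  rw [← cancel_mono (θ.hom.app X)]
  refine Eq.trans ?_ h.symm
  ext Z x
  have e := types_congr_hom ((θ.hom.app X).naturality (c • 𝟙 Z.unop).op) x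
  rw [NatTrans.comp_app, inclusion_map_indScalar]
  refine e.trans ?_
  simp

theorem smul_def_ind (c : F) {X Y : Ind T} (f : X ⟶ Y) : c • f = indScalar F c X ≫ f := rfl

instance : (Ind.yoneda (C := T)).Linear F where
  map_smul f c := by
    rw [smul_def_ind, indScalar_yoneda, ← Functor.map_comp]
    simp

end IndAbelian


/-! ### The abelian category of modules in ind-objects -/

namespace IndModule

variable {F : Type w} {F' : Type v} [Field F] [Field F'] [Algebra F F']
variable {T : Type u} [Category.{v} T] [Abelian T] [Linear F T]

theorem smulHom_algebraMap (X : IndModule F F' T) (c : F) :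
    X.smulHom (algebraMap F F' c) = c • 𝟙 X.obj :=
  X.act.commutes c

/-- Construct a module from operators satisfying the module axioms. -/
noncomputable def ofSmul (P : Ind T) (s : F' → (P ⟶ P)) (one : s 1 = 𝟙 P)
    (mul : ∀ a b, s (a * b) = s b ≫ s a) (add : ∀ a b, s (a + b) = s a + s b)
    (scalar : ∀ c : F, s (algebraMap F F' c) = c • 𝟙 P) : IndModule F F' T where
  obj := P
  act :=
    { toFun := s
      map_one' := one
      map_mul' := mul
      map_zero' := by simpa using scalar 0
      map_add' := add
      commutes' := scalar }

/-- The module structure on a subobject stable under the action. -/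
noncomputable def ofMono (X : IndModule F F' T) {P : Ind T} (i : P ⟶ X.obj) [Mono i]
    (s : F' → (P ⟶ P)) (hs : ∀ a, s a ≫ i = i ≫ X.smulHom a) : IndModule F F' T :=
  ofSmul P s
    (by rw [← cancel_mono i, hs, smulHom_one]; simp)
    (fun a b => by
      rw [← cancel_mono i, hs, smulHom_mul, Category.assoc, hs, ← Category.assoc, ← Category.assoc,
        hs])
    (fun a b => by rw [← cancel_mono i, Preadditive.add_comp, hs, hs, hs, smulHom_add]; simp)
    (fun c => by rw [← cancel_mono i, hs, smulHom_algebraMap]; simp)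

/-- The module structure on a quotient stable under the action. -/
noncomputable def ofEpi (X : IndModule F F' T) {P : Ind T} (p : X.obj ⟶ P) [Epi p]
    (s : F' → (P ⟶ P)) (hs : ∀ a, p ≫ s a = X.smulHom a ≫ p) : IndModule F F' T :=
  ofSmul P s
    (by rw [← cancel_epi p, hs, smulHom_one]; simp)
    (fun a b => by
      rw [← cancel_epi p, hs, smulHom_mul, Category.assoc, ← hs a, ← Category.assoc, ← hs b,
        Category.assoc])
    (fun a b => by rw [← cancel_epi p, Preadditive.comp_add, hs, hs, hs, smulHom_add]; simp)
    (fun c => by rw [← cancel_epi p, hs, smulHom_algebraMap]; simp)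

variable (F F' T) in
/-- The functor forgetting the action. -/
noncomputable def forget : IndModule F F' T ⥤ Ind T where
  obj X := X.obj
  map f := f.hom

instance : (forget F F' T).Additive where

instance : (forget F F' T).ReflectsIsomorphisms where
  reflects {X Y} f h := by
    have h' : IsIso f.hom := h
    let g : Y ⟶ X := ⟨inv f.hom, fun a => by
      rw [← cancel_epi f.hom, ← Category.assoc, ← f.comm]
      simp⟩
    exact ⟨⟨g, hom_ext (IsIso.hom_inv_id f.hom), hom_ext (IsIso.inv_hom_id f.hom)⟩⟩

/-- The lift of a homomorphism of modules through a monomorphism of modules. -/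
noncomputable def liftOfMono {A X W : IndModule F F' T} (i : A ⟶ X) [Mono i.hom] (g : W ⟶ X)
    (l : W.obj ⟶ A.obj) (hl : l ≫ i.hom = g.hom) : W ⟶ A where
  hom := l
  comm a := by
    rw [← cancel_mono i.hom, Category.assoc, Category.assoc, i.comm, hl, ← Category.assoc, hl,
      g.comm]

/-- The factorization of a homomorphism of modules through an epimorphism of modules. -/
noncomputable def descOfEpi {A X W : IndModule F F' T} (p : X ⟶ A) [Epi p.hom] (g : X ⟶ W)
    (l : A.obj ⟶ W.obj) (hl : p.hom ≫ l = g.hom) : A ⟶ W where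
  hom := l
  comm a := by
    rw [← cancel_epi p.hom, ← Category.assoc, ← Category.assoc, ← p.comm, hl, Category.assoc, hl,
      g.comm]

section Kernels

variable {X Y : IndModule F F' T} (f : X ⟶ Y)

/-- The kernel of a homomorphism of modules. -/
noncomputable def ker : IndModule F F' T :=
  X.ofMono (kernel.ι f.hom)
    (fun a => kernel.lift f.hom (kernel.ι f.hom ≫ X.smulHom a) (by simp [f.comm]))
    (fun a => by simp)

/-- The inclusion of the kernel of a homomorphism of modules. -/
noncomputable def kerι : ker f ⟶ X where
  hom := kernel.ι f.hom
  comm _ := kernel.lift_ι _ _ _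

instance : Mono (kerι f).hom := inferInstanceAs (Mono (kernel.ι f.hom))

theorem kerι_comp : kerι f ≫ f = 0 := hom_ext (kernel.condition f.hom)

/-- `ker f` is a kernel of `f`. -/
noncomputable def kerIsLimit : IsLimit (KernelFork.ofι (kerι f) (kerι_comp f)) :=
  KernelFork.IsLimit.ofι _ _
    (fun g hg =>
      liftOfMono (kerι f) g (kernel.lift f.hom g.hom (congrArg Hom.hom hg))
        (kernel.lift_ι _ _ _))
    (fun _ _ => hom_ext (kernel.lift_ι _ _ _))
    (fun _ _ _ hm => hom_ext ((cancel_mono (kerι f).hom).1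
      ((congrArg Hom.hom hm).trans (kernel.lift_ι _ _ _).symm)))

/-- The cokernel of a homomorphism of modules. -/
noncomputable def coker : IndModule F F' T :=
  Y.ofEpi (cokernel.π f.hom)
    (fun a => cokernel.desc f.hom (Y.smulHom a ≫ cokernel.π f.hom) (by
      rw [← Category.assoc, ← f.comm, Category.assoc, cokernel.condition, comp_zero]))
    (fun a => by simp)

/-- The projection to the cokernel of a homomorphism of modules. -/
noncomputable def cokerπ : Y ⟶ coker f where
  hom := cokernel.π f.hom
  comm _ := (cokernel.π_desc _ _ _).symm

instance : Epi (cokerπ f).hom := inferInstanceAs (Epi (cokernel.π f.hom))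

theorem comp_cokerπ : f ≫ cokerπ f = 0 := hom_ext (cokernel.condition f.hom)

/-- `coker f` is a cokernel of `f`. -/
noncomputable def cokerIsColimit : IsColimit (CokernelCofork.ofπ (cokerπ f) (comp_cokerπ f)) :=
  CokernelCofork.IsColimit.ofπ _ _
    (fun g hg =>
      descOfEpi (cokerπ f) g (cokernel.desc f.hom g.hom (congrArg Hom.hom hg))
        (cokernel.π_desc _ _ _))
    (fun _ _ => hom_ext (cokernel.π_desc _ _ _))
    (fun _ _ _ hm => hom_ext ((cancel_epi (cokerπ f).hom).1
      ((congrArg Hom.hom hm).trans (cokernel.π_desc _ _ _).symm)))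

instance : HasKernels (IndModule F F' T) where
  has_limit f := ⟨⟨_, kerIsLimit f⟩⟩

instance : HasCokernels (IndModule F F' T) where
  has_colimit f := ⟨⟨_, cokerIsColimit f⟩⟩

instance : PreservesLimit (parallelPair f 0) (forget F F' T) :=
  preservesLimit_of_preserves_limit_cone (kerIsLimit f)
    ((KernelFork.isLimitMapConeEquiv _ _).symm (kernelIsKernel f.hom))

instance : PreservesColimit (parallelPair f 0) (forget F F' T) :=
  preservesColimit_of_preserves_colimit_cocone (cokerIsColimit f)
    ((CokernelCofork.isColimitMapCoconeEquiv _ _).symm (cokernelIsCokernel f.hom))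

end Kernels

section Biproducts

variable (X Y : IndModule F F' T)

/-- The direct sum of two modules. -/
noncomputable def sum : IndModule F F' T :=
  ofSmul (X.obj ⊞ Y.obj) (fun a => biprod.map (X.smulHom a) (Y.smulHom a))
    (by ext <;> simp [smulHom_one])
    (fun a b => by ext <;> simp [smulHom_mul])
    (fun a b => by ext <;> simp [smulHom_add])
    (fun c => by ext <;> simp [smulHom_algebraMap])

/-- The direct sum of two modules as a binary bicone. -/
noncomputable def sumBicone : BinaryBicone X Y where
  pt := sum X Y
  fst := { hom := biprod.fst, comm := fun _ => biprod.map_fst _ _ }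
  snd := { hom := biprod.snd, comm := fun _ => biprod.map_snd _ _ }
  inl := { hom := biprod.inl, comm := fun _ => (biprod.inl_map _ _).symm }
  inr := { hom := biprod.inr, comm := fun _ => (biprod.inr_map _ _).symm }
  inl_fst := hom_ext biprod.inl_fst
  inl_snd := hom_ext biprod.inl_snd
  inr_fst := hom_ext biprod.inr_fst
  inr_snd := hom_ext biprod.inr_snd

instance : HasBinaryBiproducts (IndModule F F' T) where
  has_binary_biproduct X Y := hasBinaryBiproduct_of_total (sumBicone X Y) (hom_ext biprod.total)

open ZeroObject in
instance : HasZeroObject (IndModule F F' T) :=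
  ⟨ofSmul (0 : Ind T) (fun _ => 0) (Subsingleton.elim _ _) (fun _ _ => Subsingleton.elim _ _)
      (fun _ _ => Subsingleton.elim _ _) (fun _ => Subsingleton.elim _ _),
    ((IsZero.iff_id_eq_zero _).2 (hom_ext ((isZero_zero (Ind T)).eq_of_src _ _)))⟩

instance : HasFiniteProducts (IndModule F F' T) :=
  hasFiniteProducts_of_has_binary_and_terminal

end Biproducts

/-- The forgetful functor preserves kernels and cokernels and reflects isomorphisms, so this is
inherited from `Ind T`. -/
instance {X Y : IndModule F F' T} (f : X ⟶ Y) : IsIso (Abelian.coimageImageComparison f) := by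
  have : IsIso ((forget F F' T).map (Abelian.coimageImageComparison f)) := by
    rw [Arrow.isIso_iff_isIso_of_isIso
      (Abelian.PreservesCoimageImageComparison.iso (forget F F' T) f).hom]
    infer_instance
  exact isIso_of_reflects_iso _ (forget F F' T)

noncomputable instance (priority := 100) : Abelian (IndModule F F' T) :=
  .ofCoimageImageComparisonIsIso

instance : (forget F F' T).PreservesEpimorphisms :=
  NormalMonoCategory.preservesEpimorphisms_of_preservesCokernels _

end IndModule

/-! ### Free modules and the adjunction with the forgetful functor -/

section Free

variable (F : Type w) (F' : Type v) [Field F] [Field F'] [Algebra F F']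
variable {T : Type u} [Category.{v} T] [Abelian T] [Linear F T]

/-- The morphism `a ⊗ - : X ⟶ F' ⊗ X`. -/
noncomputable def freeIns (X : Ind T) : F' →ₗ[F] (X ⟶ (indScalarExt F F' X).obj) := extIns F X

variable {F F'}

theorem freeIns_smulHom (X : Ind T) (a b : F') :
    freeIns F F' X a ≫ (indScalarExt F F' X).smulHom b = freeIns F F' X (b * a) :=
  (extIns_map F (LinearMap.mulLeft F b) (𝟙 X) a).trans (Category.id_comp _)

/-- Since a ⊗ x = a · (1 ⊗ x), a homomorphism from a free module is determined on 1 ⊗ X. -/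
theorem free_hom_ext {X : Ind T} {Y : IndModule F F' T} {f g : indScalarExt F F' X ⟶ Y}
    (h : freeIns F F' X 1 ≫ f.hom = freeIns F F' X 1 ≫ g.hom) : f = g :=
  IndModule.hom_ext (ext_hom_ext F fun m => by
    change freeIns F F' X m ≫ f.hom = freeIns F F' X m ≫ g.hom
    rw [← mul_one m, ← freeIns_smulHom, Category.assoc, Category.assoc, f.comm, g.comm,
      ← Category.assoc, h, Category.assoc])

/-- The homomorphism of modules `F' ⊗ X ⟶ Y` induced by a morphism from `X` to the underlying
ind-object of `Y`. -/
noncomputable def freeDesc {X : Ind T} {Y : IndModule F F' T} (g : X ⟶ Y.obj) :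
    indScalarExt F F' X ⟶ Y :=
  let l : F' →ₗ[F] (X ⟶ Y.obj) :=
    { toFun := fun a : F' => g ≫ Y.smulHom a
      map_add' := fun a b => by simp [IndModule.smulHom_add]
      map_smul' := fun c a => by
        rw [Algebra.smul_def, IndModule.smulHom_mul, IndModule.smulHom_algebraMap]
        simp }
  have hl : ∀ m, freeIns F F' X m ≫ extDesc F l = g ≫ Y.smulHom m := fun m => extIns_desc F l m
  { hom := extDesc F l
    comm := fun a => ext_hom_ext F fun m => by
      change freeIns F F' X m ≫ _ = freeIns F F' X m ≫ _
      refine (Category.assoc _ _ _).symm.trans (Eq.trans ?_ (Category.assoc _ _ _))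
      rw [freeIns_smulHom, hl]
      refine Eq.trans ?_ (congrArg (· ≫ Y.smulHom a) (hl m)).symm
      rw [IndModule.smulHom_mul, Category.assoc] }

theorem freeIns_desc {X : Ind T} {Y : IndModule F F' T} (g : X ⟶ Y.obj) :
    freeIns F F' X 1 ≫ (freeDesc g).hom = g :=
  (extIns_desc F _ 1).trans (by
    change g ≫ Y.smulHom 1 = g
    rw [IndModule.smulHom_one, Category.comp_id])

variable (F F')

/-- Morphisms from `F' ⊗ X` to a module are morphisms from `X` to the underlying ind-object. -/
noncomputable def freeHomEquiv (X : Ind T) (Y : IndModule F F' T) :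
    (indScalarExt F F' X ⟶ Y) ≃ (X ⟶ Y.obj) where
  toFun f := freeIns F F' X 1 ≫ f.hom
  invFun g := freeDesc g
  left_inv _ := free_hom_ext (freeIns_desc _)
  right_inv g := freeIns_desc g

variable {F F'} in
/-- The homomorphism of modules `F' ⊗ X ⟶ F' ⊗ Y` induced by a morphism `X ⟶ Y`. -/
noncomputable def freeMap {X Y : Ind T} (f : X ⟶ Y) : indScalarExt F F' X ⟶ indScalarExt F F' Y where
  hom := extMap F LinearMap.id f
  comm a := by
    rw [indScalarExt_smulHom, indScalarExt_smulHom]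
    refine (extMap_comp F _ _ _ _).symm.trans (Eq.trans ?_ (extMap_comp F _ _ _ _))
    simp

/-- The functor `X ↦ F' ⊗ X`. -/
noncomputable def free : Ind T ⥤ IndModule F F' T where
  obj X := indScalarExt F F' X
  map f := freeMap f
  map_id _ := IndModule.hom_ext (extMap_id F _)
  map_comp _ _ := IndModule.hom_ext (extMap_comp F LinearMap.id LinearMap.id _ _)

theorem freeIns_map {X Y : Ind T} (f : X ⟶ Y) (a : F') :
    freeIns F F' X a ≫ (freeMap f).hom = f ≫ freeIns F F' Y a :=
  extIns_map F LinearMap.id f a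

/-- The functor `free` is left adjoint to the forgetful functor. -/
noncomputable def freeAdj : free F F' (T := T) ⊣ IndModule.forget F F' T :=
  Adjunction.mkOfHomEquiv
    { homEquiv := fun X Y => freeHomEquiv F F' X Y
      homEquiv_naturality_left_symm := fun {X' X Y} f (g : X ⟶ Y.obj) =>
        free_hom_ext ((freeIns_desc (f ≫ g)).trans (by
          change _ = freeIns F F' X' 1 ≫ (freeMap f).hom ≫ (freeDesc g).hom
          rw [← Category.assoc, freeIns_map, Category.assoc]
          exact congrArg (f ≫ ·) (freeIns_desc g).symm))
      homEquiv_naturality_right := fun {X Y Y'} f g => by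
        change freeIns F F' X 1 ≫ IndModule.Hom.hom f ≫ g.hom = (freeIns F F' X 1 ≫ IndModule.Hom.hom f) ≫ g.hom
        rw [Category.assoc] }

/-- The functor is the Yoneda embedding, which preserves finite colimits, followed by the left
adjoint `free`. -/
instance : PreservesFiniteColimits (scalarExtFunctor F T F') :=
  have := (freeAdj F F' (T := T)).leftAdjoint_preservesColimits
  have : PreservesFiniteColimits (free F F' (T := T)) := inferInstance
  inferInstanceAs (PreservesFiniteColimits (Ind.yoneda ⋙ free F F'))

end Free


/-! ### Morphisms between the objects t(X): Hom(tW, tX) = F' ⊗ Hom(W, X) -/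

section BaseChange

variable {F : Type w} {F' : Type v} [Field F] [Field F'] [Algebra F F']
variable {T : Type u} [Category.{v} T] [Abelian T] [Linear F T]

variable (F) in
/-- The morphism `a ⊗ -` from `X` to the ind-object underlying `t(X)`. -/
noncomputable def tIns (X : T) :
    F' →ₗ[F] (Ind.yoneda.obj X ⟶ ((scalarExtFunctor F T F').obj X).obj) :=
  freeIns F F' (Ind.yoneda.obj X)

theorem tIns_smulHom (X : T) (a b : F') :
    tIns F X a ≫ ((scalarExtFunctor F T F').obj X).smulHom b = tIns F X (b * a) :=
  freeIns_smulHom _ _ _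

theorem tIns_map {X Y : T} (f : X ⟶ Y) (a : F') :
    tIns F X a ≫ ((scalarExtFunctor F T F').map f).hom = Ind.yoneda.map f ≫ tIns F Y a :=
  freeIns_map F F' (Ind.yoneda.map f) a

/-- The value at `1 ⊗ -` of a homomorphism of modules `t(W) ⟶ Y`. -/
noncomputable def freeEval (W : T) (Y : IndModule F F' T) :
    ((scalarExtFunctor F T F').obj W ⟶ Y) →+ (Ind.yoneda.obj W ⟶ Y.obj) where
  toFun f := tIns F W 1 ≫ f.hom
  map_zero' := comp_zero
  map_add' f g := Preadditive.comp_add _ _ _ _ f.hom g.hom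

theorem freeEval_injective (W : T) (Y : IndModule F F' T) :
    Function.Injective (freeEval (F := F) W Y) := fun _ _ h => free_hom_ext h

theorem freeEval_surjective (W : T) (Y : IndModule F F' T) :
    Function.Surjective (freeEval (F := F) W Y) := fun g => ⟨freeDesc g, freeIns_desc g⟩

theorem freeEval_map {W X : T} (f : W ⟶ X) :
    freeEval W _ ((scalarExtFunctor F T F').map f) = Ind.yoneda.map f ≫ tIns F X (1 : F') :=
  tIns_map f 1

theorem freeEval_comp {W : T} {Y Z : IndModule F F' T} (f : (scalarExtFunctor F T F').obj W ⟶ Y)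
    (g : Y ⟶ Z) : freeEval W Z (f ≫ g) = freeEval W Y f ≫ g.hom := by
  change tIns F W 1 ≫ f.hom ≫ g.hom = (tIns F W 1 ≫ f.hom) ≫ g.hom
  rw [Category.assoc]

theorem freeEval_map_comp {V W : T} {Y : IndModule F F' T} (k : V ⟶ W)
    (f : (scalarExtFunctor F T F').obj W ⟶ Y) :
    freeEval V Y ((scalarExtFunctor F T F').map k ≫ f) = Ind.yoneda.map k ≫ freeEval W Y f := by
  rw [freeEval_comp, freeEval_map, Category.assoc]
  rfl

theorem freeEval_smul {W : T} {Y : IndModule F F' T} (a : F')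
    (f : (scalarExtFunctor F T F').obj W ⟶ Y) :
    freeEval W Y (a • f) = freeEval W Y f ≫ Y.smulHom a := by
  change tIns F W 1 ≫ f.hom ≫ Y.smulHom a = (tIns F W 1 ≫ f.hom) ≫ Y.smulHom a
  rw [Category.assoc]

theorem freeEval_smul_map {W X : T} (a : F') (f : W ⟶ X) :
    freeEval W _ (a • (scalarExtFunctor F T F').map f) = Ind.yoneda.map f ≫ tIns F X a := by
  rw [freeEval_smul, freeEval_map, Category.assoc, tIns_smulHom, mul_one]

instance : (scalarExtFunctor F T F').Additive where
  map_add {X Y f g} := freeEval_injective _ _ (by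
    rw [map_add, freeEval_map, freeEval_map, freeEval_map, Functor.map_add, Preadditive.add_comp])

theorem scalarExtFunctor_map_smul {X Y : T} (c : F) (f : X ⟶ Y) :
    (scalarExtFunctor F T F').map (c • f) =
      algebraMap F F' c • (scalarExtFunctor F T F').map f :=
  freeEval_injective _ _ (by
    rw [freeEval_smul_map, freeEval_map, Functor.map_smul, ← mul_one (algebraMap F F' c),
      ← Algebra.smul_def, map_smul, Linear.smul_comp, Linear.comp_smul])

/-- The coordinate `t(X) ⟶ X` attached to a linear form. -/
noncomputable def tCoord (X : T) (l : F' →ₗ[F] F) :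
    ((scalarExtFunctor F T F').obj X).obj ⟶ Ind.yoneda.obj X :=
  extDesc F (l.smulRight (𝟙 (Ind.yoneda.obj X)))

theorem tIns_coord (X : T) (l : F' →ₗ[F] F) (a : F') : tIns F X a ≫ tCoord X l = l a • 𝟙 _ :=
  extIns_desc F _ a

/-- A finite coproduct in a preadditive category is a biproduct; the Kronecker-delta morphisms are
its projections. -/
theorem eq_sum_sigma_ι {C : Type*} [Category* C] [Preadditive C] {ι : Type*} [Fintype ι]
    [DecidableEq ι] {W X : C} [HasCoproduct fun _ : ι => X] (g : W ⟶ ∐ fun _ : ι => X) :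
    g = ∑ i, (g ≫ Sigma.desc fun j => if j = i then 𝟙 X else 0) ≫ Sigma.ι (fun _ : ι => X) i := by
  have : 𝟙 (∐ fun _ : ι => X) = ∑ i, (Sigma.desc fun j => if j = i then 𝟙 X else 0) ≫
      Sigma.ι (fun _ : ι => X) i := by
    refine Sigma.hom_ext _ _ fun j => ?_
    rw [Preadditive.comp_sum, Finset.sum_eq_single j]
    · simp
    · intro i _ hi
      rw [Sigma.ι_desc_assoc, if_neg (Ne.symm hi), zero_comp]
    · simp
  conv_lhs => rw [← Category.comp_id g, this, Preadditive.comp_sum]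
  simp only [Category.assoc]

/-- The restriction of `h` to 1 ⊗ W maps a representable to a coproduct of copies of `X` indexed by
a basis of `F'`. It involves finitely many of them, and its coordinates come from morphisms of `T`
by full faithfulness of Yoneda. This is the spanning half of `homBasis`. -/
theorem exists_eq_sum_smul_map {W X : T}
    (h : (scalarExtFunctor F T F').obj W ⟶ (scalarExtFunctor F T F').obj X) :
    ∃ (ι : Type v) (_ : Fintype ι) (a : ι → F') (f : ι → (W ⟶ X)),
      h = ∑ i, a i • (scalarExtFunctor F T F').map (f i) := by
  classical
  obtain ⟨s, g, hg⟩ := exists_finset_factor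
    (fun _ : Module.Free.ChooseBasisIndex F F' => Ind.yoneda.obj X) W
    (freeEval W _ h)
  refine ⟨s, inferInstance, fun i => Module.Free.chooseBasis F F' i.1.as,
    fun i => Ind.yoneda.preimage
      (g ≫ Sigma.desc fun j => if j = i then 𝟙 (Ind.yoneda.obj X) else 0),
    freeEval_injective _ _ ?_⟩
  rw [← hg, map_sum]
  conv_lhs => rw [eq_sum_sigma_ι g]
  refine (Preadditive.sum_comp _ _ _).trans (Finset.sum_congr rfl fun i _ => ?_)
  rw [freeEval_smul_map, Functor.map_preimage, Category.assoc, Sigma.ι_desc]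
  exact congrArg _ (extIns_basis F _ _).symm

/-- A linear form F' → F turns an `F'`-linear relation among the `t(e k)` into an `F`-linear
relation among the `e k`. Thus every linear form vanishes on the coefficients. -/
theorem linearIndependent_map {W X : T} {κ : Type*} (e : Module.Basis κ F (W ⟶ X)) :
    LinearIndependent F' fun k => (scalarExtFunctor F T F').map (e k) := by
  rw [linearIndependent_iff']
  intro s a h k hk
  have key : ∀ l : F' →ₗ[F] F, l (a k) = 0 := by
    intro l
    have h0 : ∑ k ∈ s, Ind.yoneda.map (e k) ≫ tIns F X (a k) = 0 := by
      simpa [freeEval_smul_map] using congrArg (freeEval W _) h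
    have h1 : Ind.yoneda.map (∑ k ∈ s, l (a k) • e k) = 0 := by
      have := congrArg (· ≫ tCoord X l) h0
      simp only [Preadditive.sum_comp, Category.assoc, tIns_coord, zero_comp] at this
      rw [Functor.map_sum, ← this]
      refine Finset.sum_congr rfl fun k _ => ?_
      simp
    have h2 : ∑ k ∈ s, l (a k) • e k = 0 := Ind.yoneda.map_injective (by simpa using h1)
    exact linearIndependent_iff'.1 e.linearIndependent s _ h2 k hk
  exact (Module.Free.chooseBasis F F').ext_elem fun i => by
    simpa using key ((Module.Free.chooseBasis F F').coord i)

/-- The morphisms `t(W) ⟶ t(X)` are obtained from the morphisms `W ⟶ X` by extension of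
scalars. -/
noncomputable def homBasis {W X : T} {κ : Type*} (e : Module.Basis κ F (W ⟶ X)) :
    Module.Basis κ F' ((scalarExtFunctor F T F').obj W ⟶ (scalarExtFunctor F T F').obj X) :=
  .mk (linearIndependent_map e) (by
    intro h _
    obtain ⟨ι, _, a, f, rfl⟩ := exists_eq_sum_smul_map h
    refine Submodule.sum_mem _ fun i _ => Submodule.smul_mem _ _ ?_
    rw [← e.linearCombination_repr (f i), Finsupp.linearCombination_apply, Finsupp.sum,
      Functor.map_sum]
    refine Submodule.sum_mem _ fun k _ => ?_
    rw [scalarExtFunctor_map_smul]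
    exact Submodule.smul_mem _ _ (Submodule.subset_span ⟨k, rfl⟩))

theorem homBasis_apply {W X : T} {κ : Type*} (e : Module.Basis κ F (W ⟶ X)) (k : κ) :
    homBasis (F' := F') e k = (scalarExtFunctor F T F').map (e k) :=
  Module.Basis.mk_apply _ _ _

end BaseChange


/-! ### Objects of finite length in an abelian category -/

section FiniteLength

variable {C : Type u} [Category.{v} C]

theorem strictMono_of_forall_le {α β : Type*} [PartialOrder α] [PartialOrder β] {f : α → β}
    (hf : Monotone f) (h : ∀ a b, a ≤ b → f b ≤ f a → b ≤ a) : StrictMono f := fun a b hab =>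
  lt_of_le_not_ge (hf hab.le) fun hba => hab.not_ge (h a b hab.le hba)

theorem hasFiniteLength_of_strictMono {X : C} {β : Type*} [PartialOrder β] [WellFoundedLT β]
    [WellFoundedGT β] {f : Subobject X → β} (hf : StrictMono f) : HasFiniteLength C X :=
  ⟨⟨hf.wellFoundedLT⟩, ⟨hf.wellFoundedGT⟩⟩

theorem hasFiniteLength_of_mono {X Y : C} (i : X ⟶ Y) [Mono i] (hY : HasFiniteLength C Y) :
    HasFiniteLength C X :=
  have := hY.1
  have := hY.2
  ⟨isArtinianObject_of_mono i, isNoetherianObject_of_mono i⟩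

variable [Abelian C]

theorem subobject_factors_iff {X A : C} (S : Subobject X) (f : A ⟶ X) :
    S.Factors f ↔ f ≫ cokernel.π S.arrow = 0 := by
  refine ⟨fun h => ?_, fun h => ?_⟩
  · rw [← S.factorThru_arrow f h, Category.assoc, cokernel.condition, comp_zero]
  · have := Abelian.monoLift_comp S.arrow f h
    rw [← this]
    exact Subobject.factors_comp_arrow _

/-- Factoring through `S` is the vanishing of a composite with the cokernel of `S`, and an
epimorphism can be cancelled there. With this, subobjects are handled by generalized elements up to
epimorphic refinement. -/
theorem subobject_factors_of_epi {X A B : C} (S : Subobject X) (p : B ⟶ A) [Epi p] (f : A ⟶ X)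
    (h : S.Factors (p ≫ f)) : S.Factors f := by
  rw [subobject_factors_iff] at h ⊢
  rwa [← cancel_epi p, comp_zero, ← Category.assoc]

theorem subobject_pullback_factors_iff {X Y A : C} (i : X ⟶ Y) (S : Subobject Y) (x : A ⟶ X) :
    ((Subobject.pullback i).obj S).Factors x ↔ S.Factors (x ≫ i) := by
  have hp := Subobject.isPullback i S
  refine ⟨fun h => ?_, fun h => ?_⟩
  · rw [← Subobject.factorThru_arrow _ x h, Category.assoc, ← hp.w, ← Category.assoc]
    exact Subobject.factors_comp_arrow _
  · rw [← hp.lift_snd (S.factorThru _ h) x (S.factorThru_arrow _ h)]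
    exact Subobject.factors_comp_arrow _

theorem imageSubobject_factors_iff {X Y A : C} (g : X ⟶ Y) (f : A ⟶ Y) :
    (imageSubobject g).Factors f ↔
      ∃ (A' : C) (π : A' ⟶ A) (_ : Epi π) (x : A' ⟶ X), π ≫ f = x ≫ g := by
  refine ⟨fun h => ?_, fun ⟨A', π, _, x, hx⟩ => ?_⟩
  · have : Epi (factorThruImageSubobject g) := inferInstance
    obtain ⟨A', π, hπ, x, hx⟩ := surjective_up_to_refinements_of_epi
      (factorThruImageSubobject g) ((imageSubobject g).factorThru f h)
    refine ⟨A', π, hπ, x, ?_⟩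
    rw [← (imageSubobject g).factorThru_arrow f h, ← Category.assoc, hx, Category.assoc,
      imageSubobject_arrow_comp]
  · refine subobject_factors_of_epi _ π f ?_
    have h : π ≫ f = (x ≫ factorThruImageSubobject g) ≫ (imageSubobject g).arrow := by
      rw [hx, Category.assoc, imageSubobject_arrow_comp]
    rw [h]
    exact Subobject.factors_comp_arrow _

/-- Preimage along an epimorphism reflects the order of subobjects, because morphisms to `Y` lift to
`X` after refinement. -/
theorem hasFiniteLength_of_epi {X Y : C} (p : X ⟶ Y) [Epi p] (hX : HasFiniteLength C X) :
    HasFiniteLength C Y := by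
  have := hX.1
  have := hX.2
  refine hasFiniteLength_of_strictMono (f := (Subobject.pullback p).obj)
    (strictMono_of_forall_le (Subobject.pullback p).monotone fun S S' _ h => ?_)
  refine Subobject.le_of_factors ?_
  obtain ⟨A, π, hπ, x, hx⟩ := surjective_up_to_refinements_of_epi p S'.arrow
  refine subobject_factors_of_epi _ π _ ?_
  rw [hx, ← subobject_pullback_factors_iff]
  refine Subobject.factors_of_le _ h ?_
  rw [subobject_pullback_factors_iff, ← hx]
  exact Subobject.factors_comp_arrow _

/-- A subobject `P` is recorded by its trace on `X₁` and its image in `X₃`. If P ≤ Q have the same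
record, an element of `Q` differs from an element of `P` with the same image by an element coming
from `X₁`. The difference lies in `Q`, hence in `P` by equality of traces. -/
theorem hasFiniteLength_of_exact {S : ShortComplex C} (hS : S.Exact)
    (h₁ : HasFiniteLength C S.X₁) (h₃ : HasFiniteLength C S.X₃) : HasFiniteLength C S.X₂ := by
  have := h₁.1
  have := h₁.2
  have := h₃.1
  have := h₃.2
  refine hasFiniteLength_of_strictMono
    (f := fun P => ((Subobject.pullback S.f).obj P, imageSubobject (P.arrow ≫ S.g)))
    (strictMono_of_forall_le (fun P Q h => ⟨(Subobject.pullback S.f).monotone h, ?_⟩)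
      fun P Q hPQ h => ?_)
  · refine Subobject.le_of_factors ((imageSubobject_factors_iff _ _).2 ?_)
    obtain ⟨A, π, hπ, x, hx⟩ := (imageSubobject_factors_iff (P.arrow ≫ S.g) _).1
      (Subobject.factors_self _)
    exact ⟨A, π, hπ, x ≫ Subobject.ofLE _ _ h, by simp [hx]⟩
  · refine Subobject.le_of_factors ?_
    obtain ⟨A, π, hπ, x, hx⟩ := (imageSubobject_factors_iff (P.arrow ≫ S.g) (Q.arrow ≫ S.g)).1
      (Subobject.factors_of_le _ h.2 ((imageSubobject_factors_iff _ _).2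
        ⟨_, 𝟙 _, inferInstance, 𝟙 _, rfl⟩))
    obtain ⟨B, ρ, hρ, y, hy⟩ := hS.exact_up_to_refinements (π ≫ Q.arrow - x ≫ P.arrow)
      (by rw [Preadditive.sub_comp, Category.assoc, hx, Category.assoc, sub_self])
    have hyP : P.Factors (y ≫ S.f) := by
      rw [← subobject_pullback_factors_iff]
      refine Subobject.factors_of_le _ h.1 ?_
      rw [subobject_pullback_factors_iff, ← hy, subobject_factors_iff, Preadditive.comp_sub,
        Preadditive.sub_comp, Category.assoc, Category.assoc, cokernel.condition, comp_zero,
        comp_zero, zero_sub, neg_eq_zero, Category.assoc, Category.assoc,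
        (subobject_factors_iff _ _).1 (Subobject.factors_of_le _ hPQ (Subobject.factors_self P)),
        comp_zero, comp_zero]
    have h1 : ρ ≫ π ≫ Q.arrow = y ≫ S.f + ρ ≫ x ≫ P.arrow := by
      rw [← hy, Preadditive.comp_sub, sub_add_cancel]
    refine subobject_factors_of_epi _ (ρ ≫ π) _ ?_
    rw [Category.assoc, h1]
    refine Subobject.factors_add _ _ hyP ?_
    rw [← Category.assoc]
    exact Subobject.factors_comp_arrow _

/-- Together with closure under finite products, this gives the abelian structure on the full
subcategory of objects of finite length. -/
instance isSerreClass_hasFiniteLength : (HasFiniteLength C).IsSerreClass where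
  exists_zero := ⟨_, isZero_zero C, ⟨isArtinianObject_of_isZero (isZero_zero C),
    isNoetherianObject_of_isZero (isZero_zero C)⟩⟩
  prop_of_mono i _ h := hasFiniteLength_of_mono i h
  prop_of_epi p _ h := hasFiniteLength_of_epi p h
  prop_X₂_of_shortExact hS h₁ h₃ := hasFiniteLength_of_exact hS.exact h₁ h₃

instance : (HasFiniteLength C).IsClosedUnderFiniteProducts :=
  have : (HasFiniteLength C).IsClosedUnderBinaryProducts :=
    ⟨by
      rintro X ⟨p⟩
      let e : X ≅ p.diag.obj ⟨.left⟩ ⊞ p.diag.obj ⟨.right⟩ :=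
        IsLimit.conePointsIsoOfNatIso p.isLimit
          (BinaryBiproduct.isLimit (p.diag.obj ⟨.left⟩) (p.diag.obj ⟨.right⟩))
          (Discrete.natIso (by rintro ⟨_ | _⟩ <;> exact Iso.refl _))
      exact hasFiniteLength_of_mono e.hom
        (ObjectProperty.prop_biprod _ (p.prop_diag_obj _) (p.prop_diag_obj _))⟩
  .mk'

/-- If a finite family of morphisms to a simple object is jointly monic, then the identity factors
through copies of this simple object. -/
theorem exists_id_eq_sum_of_jointlyMonic {X W : C} [Simple X] {ι : Type*} (f : ι → (W ⟶ X))
    (s : Finset ι)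
    (hs : ∀ (Z : C) (z : Z ⟶ W), (∀ i ∈ s, z ≫ f i = 0) → z = 0) :
    ∃ (s' : Finset ι) (g : ι → (X ⟶ W)), 𝟙 W = ∑ i ∈ s', f i ≫ g i := by
  classical
  induction s using Finset.strongInduction with
  | H s ih =>
    -- Superfluous members are discarded by induction, so that each remaining one is needed for
    -- joint monicity.
    by_cases hj : ∃ j ∈ s, ∀ (Z : C) (z : Z ⟶ W), (∀ i ∈ s.erase j, z ≫ f i = 0) → z = 0
    · obtain ⟨j, hj, h⟩ := hj
      exact ih _ (Finset.erase_ssubset hj) h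
    · push Not at hj
      -- A nonzero `z` killed by all members except `f j` has an image that `f j` embeds in `X`.
      -- Simplicity makes this an isomorphism, and its inverse yields a morphism dual to `f j`.
      have key : ∀ j ∈ s, ∃ g : X ⟶ W, g ≫ f j = 𝟙 X ∧ ∀ i ∈ s, i ≠ j → g ≫ f i = 0 := by
        intro j hjs
        obtain ⟨Z, z, hz, hz0⟩ := hj j hjs
        have hz' : ∀ i ∈ s, i ≠ j → image.ι z ≫ f i = 0 := fun i hi hij => by
          rw [← cancel_epi (factorThruImage z), comp_zero, image.fac_assoc]
          exact hz i (Finset.mem_erase.2 ⟨hij, hi⟩)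
        have hmono : Mono (image.ι z ≫ f j) := by
          refine Preadditive.mono_of_cancel_zero _ fun {A} a ha => ?_
          rw [← cancel_mono (image.ι z), zero_comp]
          refine hs _ _ fun i hi => ?_
          by_cases hij : i = j
          · rw [hij, Category.assoc, ha]
          · rw [Category.assoc, hz' i hi hij, comp_zero]
        have hne : image.ι z ≫ f j ≠ 0 := fun h => hz0 (by
          rw [← image.fac z, hs _ (image.ι z) (fun i hi => by
            by_cases hij : i = j
            · rw [hij, h]
            · exact hz' i hi hij), comp_zero])
        have := isIso_of_mono_of_nonzero hne
        exact ⟨inv (image.ι z ≫ f j) ≫ image.ι z, by simp, fun i hi hij => by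
          rw [Category.assoc, hz' i hi hij, comp_zero]⟩
      choose! g hg1 hg2 using key
      refine ⟨s, g, ?_⟩
      rw [← sub_eq_zero]
      refine hs _ _ fun i hi => ?_
      rw [Preadditive.sub_comp, Preadditive.sum_comp, Finset.sum_eq_single i]
      · simp [hg1 i hi]
      · intro j hj hji
        rw [Category.assoc, hg2 j hj i hi hji.symm, comp_zero]
      · exact fun h => (h hi).elim

end FiniteLength


/-! ### Finite length of t(X), covers by t(W), and lifting along epimorphisms -/

section

variable {F : Type w} {F' : Type v} [Field F] [Field F'] [Algebra F F']
variable {T : Type u} [Category.{v} T] [Abelian T] [Linear F T]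

theorem indModule_hom_ext {X Y : IndModule F F' T} {f g : X ⟶ Y}
    (h : ∀ (W : T) (k : (scalarExtFunctor F T F').obj W ⟶ X), k ≫ f = k ≫ g) : f = g :=
  IndModule.hom_ext (ind_hom_ext fun W i => by
    obtain ⟨k, rfl⟩ := freeEval_surjective W X i
    rw [← freeEval_comp, ← freeEval_comp, h])

/-- `V` is the image of the morphism W ⟶ X^ι whose components are the `f i`. On it the coordinates
are jointly monic, as `exists_id_eq_sum_of_jointlyMonic` requires. -/
theorem exists_epi_factor_sum {W X : T}
    (g : (scalarExtFunctor F T F').obj W ⟶ (scalarExtFunctor F T F').obj X) :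
    ∃ (V : T) (p : W ⟶ V) (_ : Epi p) (ι : Type v) (_ : Fintype ι) (a : ι → F')
      (f : ι → (V ⟶ X)), (∀ (Z : T) (z : Z ⟶ V), (∀ i, z ≫ f i = 0) → z = 0) ∧
      g = (scalarExtFunctor F T F').map p ≫ ∑ i, a i • (scalarExtFunctor F T F').map (f i) := by
  obtain ⟨ι, _, a, f, rfl⟩ := exists_eq_sum_smul_map g
  have := Abelian.hasFiniteBiproducts (C := T)
  let l : W ⟶ ⨁ fun _ : ι => X := biproduct.lift f
  refine ⟨image l, factorThruImage l, inferInstance, ι, inferInstance, a,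
    fun i => image.ι l ≫ biproduct.π _ i, fun Z z hz => ?_, ?_⟩
  · rw [← cancel_mono (image.ι l), zero_comp]
    refine biproduct.hom_ext _ _ fun i => ?_
    rw [Category.assoc, hz, zero_comp]
  · rw [Preadditive.comp_sum]
    refine Finset.sum_congr rfl fun i _ => ?_
    rw [Linear.comp_smul, ← Functor.map_comp, image.fac_assoc, biproduct.lift_π]

/-- Subobjects of t(X) embed, strictly monotonically, in the `F'`-subspaces of End(tX) = F' ⊗
End(X), which is finite-dimensional. -/
theorem hasFiniteLength_of_simple (X : T) [Simple X] [hX : FiniteDimensional F (End X)] :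
    HasFiniteLength (IndModule F F' T) ((scalarExtFunctor F T F').obj X) := by
  let tX := (scalarExtFunctor F T F').obj X
  have : Module.Finite F (X ⟶ X) := hX
  have : Module.Finite F' (tX ⟶ tX) :=
    .of_basis (homBasis (F' := F') (Module.finBasis F (X ⟶ X)))
  let φ : Subobject tX → Submodule F' (tX ⟶ tX) := fun S =>
    { carrier := {f | S.Factors f}
      add_mem' := fun {a b} ha hb => Subobject.factors_add a b ha hb
      zero_mem' := Subobject.factors_zero
      smul_mem' := fun c f hf => by
        rw [Set.mem_ofPred_eq, subobject_factors_iff] at hf ⊢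
        rw [Linear.smul_comp, hf, smul_zero] }
  refine hasFiniteLength_of_strictMono (f := φ) (strictMono_of_forall_le
    (fun S S' h f hf => Subobject.factors_of_le f h hf) fun S S' _ h => ?_)
  refine Subobject.le_of_factors ((subobject_factors_iff _ _).2 (indModule_hom_ext fun W k => ?_))
  rw [comp_zero, ← Category.assoc, ← subobject_factors_iff]
  obtain ⟨V, p, _, ι, _, a, f, hf, hg⟩ := exists_epi_factor_sum (k ≫ S'.arrow)
  obtain ⟨s, q, hq⟩ := exists_id_eq_sum_of_jointlyMonic f Finset.univ
    (fun Z z hz => hf Z z fun i => hz i (Finset.mem_univ i))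
  set r := ∑ i, a i • (scalarExtFunctor F T F').map (f i)
  have hr : S'.Factors r := by
    refine subobject_factors_of_epi S' ((scalarExtFunctor F T F').map p) r ?_
    rw [← hg]
    exact Subobject.factors_comp_arrow _
  -- The identity of `V` is a sum of endomorphisms through `X`. Hence `r` is a sum of morphisms t(V)
  -- ⟶ t(X) followed by endomorphisms of t(X) that factor through `S'`, and these factor through `S`
  -- by `h`.
  have hr' : r = ∑ i ∈ s, (scalarExtFunctor F T F').map (f i) ≫
      (scalarExtFunctor F T F').map (q i) ≫ r := by
    conv_lhs => rw [← Category.id_comp r, ← (scalarExtFunctor F T F').map_id, hq, Functor.map_sum,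
      Preadditive.sum_comp]
    simp
  rw [hg, subobject_factors_iff, Category.assoc, hr', Preadditive.sum_comp,
    Finset.sum_eq_zero, comp_zero]
  intro i _
  rw [Category.assoc, (subobject_factors_iff S _).1 (h (Subobject.factors_of_factors_right _ hr)),
    comp_zero]

theorem hasFiniteLength_scalarExt (hfin : FFinite F T) (X : T) :
    HasFiniteLength (IndModule F F' T) ((scalarExtFunctor F T F').obj X) := by
  have := (hfin.hasFiniteLength X).2
  -- `S` is maximal among the subobjects whose image under t has finite length. If S ≠ X, the
  -- preimage `S'` of a simple subobject of X/S contradicts maximality.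
  obtain ⟨S, hS, hmax⟩ := (wellFounded_gt (α := Subobject X)).has_min
    {S | HasFiniteLength (IndModule F F' T) ((scalarExtFunctor F T F').obj (S : T))}
    ⟨⊥, (HasFiniteLength (IndModule F F' T)).prop_of_isZero
      ((scalarExtFunctor F T F').map_isZero ((isZero_zero T).of_iso Subobject.botCoeIsoZero))⟩
  by_cases hQ : IsZero (cokernel S.arrow)
  · have : Epi S.arrow := Preadditive.epi_of_cokernel_zero (hQ.eq_of_tgt _ _)
    exact hasFiniteLength_of_epi ((scalarExtFunctor F T F').map S.arrow) hS
  · exfalso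
    have := (hasFiniteLength_of_epi (cokernel.π S.arrow) (hfin.hasFiniteLength X)).1
    obtain ⟨A, hA⟩ := exists_simple_subobject hQ
    let S' := (Subobject.pullback (cokernel.π S.arrow)).obj A
    have hp := Subobject.isPullback (cokernel.π S.arrow) A
    have hfac : ∀ {B : T} (f : B ⟶ X), S'.Factors f ↔ A.Factors (f ≫ cokernel.π S.arrow) :=
      fun f => subobject_pullback_factors_iff _ _ _
    have hle : S ≤ S' := Subobject.le_of_factors (by
      rw [hfac, cokernel.condition]
      exact Subobject.factors_zero)
    let K := ShortComplex.mk (Subobject.ofLE S S' hle) (Subobject.pullbackπ _ A) (by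
      rw [← cancel_mono A.arrow, Category.assoc, hp.w, ← Category.assoc, Subobject.ofLE_arrow,
        cokernel.condition, zero_comp])
    have hKg : Epi K.g := by
      rw [epi_iff_surjective_up_to_refinements]
      intro B y
      obtain ⟨B', π, hπ, x, hx⟩ := surjective_up_to_refinements_of_epi (cokernel.π S.arrow)
        (y ≫ A.arrow)
      exact ⟨B', π, hπ, hp.lift (π ≫ y) x (by rw [Category.assoc, hx]), (hp.lift_fst _ _ _).symm⟩
    have hK : K.Exact := by
      rw [ShortComplex.exact_iff_exact_up_to_refinements]
      intro B b hb
      have : S.Factors (b ≫ S'.arrow) := by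
        rw [subobject_factors_iff, Category.assoc, ← hp.w, ← Category.assoc]
        exact (congrArg (· ≫ A.arrow) hb).trans zero_comp
      refine ⟨B, 𝟙 B, inferInstance, S.factorThru _ this, ?_⟩
      rw [← cancel_mono S'.arrow]
      simp [K]
    -- Right exactness of t keeps t(S) ⟶ t(S') ⟶ t(A) exact, which suffices for
    -- `hasFiniteLength_of_exact`; no monomorphism on the left is needed.
    have h1 := (Functor.preservesFiniteColimits_tfae (scalarExtFunctor F T F')).out 3 1
    have h2 := (h1.1 inferInstance K ⟨hK, hKg⟩).1
    have := hfin.finite_end (A : T)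
    refine hmax S' (hasFiniteLength_of_exact h2 hS (hasFiniteLength_of_simple (A : T))) ?_
    refine lt_of_le_not_ge hle fun h => Simple.not_isZero (A : T) ?_
    rw [IsZero.iff_id_eq_zero, ← cancel_epi K.g, ← cancel_mono A.arrow, Category.comp_id, hp.w,
      (subobject_factors_iff _ _).1 (Subobject.factors_of_le _ h (Subobject.factors_self _)),
      comp_zero, zero_comp]

/-- Both `v` and `k` factor through `p`. If the image of `p` is not strictly larger than that of
`v`, it equals it and so contains the image of `k`. It is applied with a `p` built on a biproduct,
as a maximality argument. -/
theorem comp_cokernel_π_eq_zero_of_maximal {C : Type*} [Category* C] [Abelian C]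
    {V U P W : C} {v : V ⟶ W} {k : U ⟶ W} {p : P ⟶ W} {i : V ⟶ P} {j : U ⟶ P} (hv : v = i ≫ p)
    (hk : k = j ≫ p) (h : ¬ imageSubobject p > imageSubobject v) : k ≫ cokernel.π v = 0 := by
  have hle : imageSubobject v ≤ imageSubobject p := by
    refine Subobject.le_of_factors ((imageSubobject_factors_iff _ _).2 ?_)
    obtain ⟨A, π, hπ, x, hx⟩ := (imageSubobject_factors_iff v _).1 (Subobject.factors_self _)
    exact ⟨A, π, hπ, x ≫ i, by rw [hx, Category.assoc, ← hv]⟩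
  have hge : imageSubobject p ≤ imageSubobject v := by
    by_contra hn
    exact h (lt_of_le_not_ge hle hn)
  obtain ⟨A, π, hπ, x, hx⟩ := (imageSubobject_factors_iff v k).1
    (Subobject.factors_of_le _ hge ((imageSubobject_factors_iff _ _).2
      ⟨_, 𝟙 _, inferInstance, j, by rw [Category.id_comp, hk]⟩))
  rw [← cancel_epi π, ← Category.assoc, hx, Category.assoc, cokernel.condition, comp_zero,
    comp_zero]

/-- Every module of finite length is a quotient of some `t(W)`. -/
theorem exists_epi_scalarExt {X : IndModule F F' T} (hX : HasFiniteLength (IndModule F F' T) X) :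
    ∃ (W : T) (p : (scalarExtFunctor F T F').obj W ⟶ X), Epi p := by
  have := hX.2
  obtain ⟨X0⟩ : Nonempty T := ⟨(Limits.HasZeroObject.zero' T).zero⟩
  obtain ⟨_, ⟨W, p, rfl⟩, hmax⟩ := (wellFounded_gt (α := Subobject X)).has_min
    {S | ∃ (W : T) (p : (scalarExtFunctor F T F').obj W ⟶ X), S = imageSubobject p}
    ⟨_, X0, 0, rfl⟩
  -- For a maximal image, adjoining any `k` to `p` through t(W ⊞ V) gives nothing new, so all
  -- morphisms from objects t(V) vanish in the cokernel.
  refine ⟨W, p, Preadditive.epi_of_cokernel_zero (indModule_hom_ext fun V k => ?_)⟩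
  let t := scalarExtFunctor F T F'
  let p' : t.obj (W ⊞ V) ⟶ X := t.map biprod.fst ≫ p + t.map biprod.snd ≫ k
  have h1 : p = t.map biprod.inl ≫ p' := by
    simp only [p', Preadditive.comp_add, ← Functor.map_comp_assoc, biprod.inl_fst, biprod.inl_snd,
      Functor.map_zero, zero_comp, add_zero]
    exact ((congrArg (· ≫ p) (t.map_id W)).trans (Category.id_comp p)).symm
  have h2 : k = t.map biprod.inr ≫ p' := by
    simp only [p', Preadditive.comp_add, ← Functor.map_comp_assoc, biprod.inr_fst, biprod.inr_snd,
      Functor.map_zero, zero_comp, zero_add]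
    exact ((congrArg (· ≫ k) (t.map_id V)).trans (Category.id_comp k)).symm
  rw [comp_zero]
  exact comp_cokernel_π_eq_zero_of_maximal h1 h2 (hmax _ ⟨_, p', rfl⟩)

/-- Morphisms `t(W) ⟶ Y` lift along epimorphisms after passing to a cover of `W`. -/
theorem exists_lift_scalarExt {X Y : IndModule F F' T} (q : X ⟶ Y) [Epi q] {W : T}
    (hW : HasFiniteLength T W) (f : (scalarExtFunctor F T F').obj W ⟶ Y) :
    ∃ (V : T) (p : V ⟶ W) (_ : Epi p) (g : (scalarExtFunctor F T F').obj V ⟶ X),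
      g ≫ q = (scalarExtFunctor F T F').map p ≫ f := by
  have := hW.2
  let t := scalarExtFunctor F T F'
  have hq : Epi q.hom := inferInstanceAs (Epi ((IndModule.forget F F' T).map q))
  -- Among the morphisms `p` for which `t.map p ≫ f` lifts through `q`, one with maximal image in
  -- `W` is taken; the zero morphism shows that there are some.
  obtain ⟨_, ⟨V, p, g, hg, rfl⟩, hmax⟩ := (wellFounded_gt (α := Subobject W)).has_min
    {S | ∃ (V : T) (p : V ⟶ W) (g : t.obj V ⟶ X), g ≫ q = t.map p ≫ f ∧ S = imageSubobject p}
    ⟨_, W, 0, 0, by simp, rfl⟩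
  refine ⟨V, p, Preadditive.epi_of_cokernel_zero (Ind.yoneda.map_injective ?_), g, hg⟩
  -- The pullback of the epimorphism `q.hom` to `W` is an epimorphism in `Ind T`, and its source is
  -- tested by representables `U`. Each gives u : U ⟶ W along which `f` lifts, so maximality puts
  -- `u` in the image of `p`.
  rw [Functor.map_zero, ← cancel_epi (pullback.fst (freeEval W Y f) q.hom), comp_zero]
  refine ind_hom_ext fun U i => ?_
  obtain ⟨u, hu⟩ := Ind.yoneda.map_surjective (i ≫ pullback.fst (freeEval W Y f) q.hom)
  obtain ⟨k, hk⟩ := freeEval_surjective U X (i ≫ pullback.snd (freeEval W Y f) q.hom)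
  have hkq : k ≫ q = t.map u ≫ f := freeEval_injective _ _ (by
    rw [freeEval_comp, freeEval_map_comp, hk, hu, Category.assoc, Category.assoc,
      pullback.condition])
  have h0 : u ≫ cokernel.π p = 0 := comp_cokernel_π_eq_zero_of_maximal
    (biprod.inl_desc p u).symm (biprod.inr_desc p u).symm
    (hmax _ ⟨V ⊞ U, _, t.map biprod.fst ≫ g + t.map biprod.snd ≫ k, ?_, rfl⟩)
  · rw [← Category.assoc, ← hu, ← Functor.map_comp, h0, Functor.map_zero, comp_zero]
  · have : biprod.desc p u = biprod.fst ≫ p + biprod.snd ≫ u := by ext <;> simp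
    rw [this, Preadditive.add_comp, Category.assoc, Category.assoc, hg, hkq, Functor.map_add,
      Functor.map_comp, Functor.map_comp, Preadditive.add_comp, Category.assoc, Category.assoc]

end


/-! ### Right exact linear functors and the abstract notion of scalar extension -/

/-- Right exact additive functors that are semilinear with respect to a homomorphism of fields. -/
structure IsRexLinear (R S : Type*) [Field R] [Field S] [Algebra R S] {D E : Type*} [Category* D]
    [Category* E] [Preadditive D] [Preadditive E] [Linear R D] [Linear S E] (G : D ⥤ E) :
    Prop where
  additive : G.Additive
  map_smul {X Y : D} (c : R) (f : X ⟶ Y) : G.map (c • f) = algebraMap R S c • G.map f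
  rightExact : PreservesFiniteColimits G

namespace IsRexLinear

variable {R S K : Type*} [Field R] [Field S] [Field K] [Algebra R S] [Algebra S K] [Algebra R K]
  [IsScalarTower R S K] {D E E' : Type*} [Category* D]
  [Category* E] [Category* E'] [Preadditive D] [Preadditive E] [Preadditive E'] [Linear R D]
  [Linear S E] [Linear K E'] {G G' : D ⥤ E} {H : E ⥤ E'}

theorem comp (hG : IsRexLinear R S G) (hH : IsRexLinear S K H) : IsRexLinear R K (G ⋙ H) where
  additive := by
    have := hG.additive
    have := hH.additive
    infer_instance
  map_smul c f := by
    rw [Functor.comp_map, hG.map_smul, hH.map_smul, ← IsScalarTower.algebraMap_apply]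
    rfl
  rightExact := by
    have := hG.rightExact
    have := hH.rightExact
    infer_instance

theorem of_iso (hG : IsRexLinear R S G) (e : G ≅ G') : IsRexLinear R S G' where
  additive := by
    have := hG.additive
    exact Functor.additive_of_iso e
  map_smul c f := by
    rw [← cancel_epi (e.hom.app _), ← e.hom.naturality, hG.map_smul, Linear.smul_comp,
      Linear.comp_smul, e.hom.naturality]
  rightExact := by
    have := hG.rightExact
    exact preservesFiniteColimits_of_natIso e

theorem map_epi (hG : IsRexLinear R S G) {X Y : D} (p : X ⟶ Y) [Epi p] : Epi (G.map p) :=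
  have := hG.rightExact
  inferInstance

/-- A right exact functor preserves cokernels. -/
noncomputable def mapIsColimit (hG : IsRexLinear R S G) {X Y Z : D} {f : X ⟶ Y} {q : Y ⟶ Z}
    {w : f ≫ q = 0} (h : IsColimit (CokernelCofork.ofπ q w)) :
    IsColimit (CokernelCofork.ofπ (f := G.map f) (G.map q) (by
      have := hG.additive
      rw [← G.map_comp, w, G.map_zero])) :=
  have := hG.additive
  have := hG.rightExact
  CokernelCofork.mapIsColimit _ h G

end IsRexLinear

/-- The properties of `t : T ⥤ T ⊗ F'` that determine the scalar extension. -/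
structure IsScalarExtension (F F' : Type*) [Field F] [Field F'] [Algebra F F'] {T : Type u}
    [Category.{v} T] [Abelian T] [Linear F T] {C : Type*} [Category* C] [Abelian C]
    [Linear F' C] (t : T ⥤ C) : Prop where
  rex : IsRexLinear F F' t
  exists_basis (W X : T) : ∃ (κ : Type v) (e : Module.Basis κ F (W ⟶ X))
    (b : Module.Basis κ F' (t.obj W ⟶ t.obj X)), ∀ k, b k = t.map (e k)
  exists_cover (X : C) : ∃ (W : T) (p : t.obj W ⟶ X), Epi p
  exists_lift {X Y : C} (q : X ⟶ Y) [Epi q] {W : T} (f : t.obj W ⟶ Y) :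
    ∃ (V : T) (p : V ⟶ W) (_ : Epi p) (g : t.obj V ⟶ X), g ≫ q = t.map p ≫ f

/-! ### Natural families of linear maps and their descent -/

section Families

variable {F F' : Type*} [Field F] [Field F'] [Algebra F F'] {T : Type u}
  [Category.{v} T] [Abelian T] [Linear F T] {C : Type*} [Category* C] [Abelian C]
  [Linear F' C] {t : T ⥤ C} (ht : IsScalarExtension F F' t)
  {E : Type*} [Category* E] [Preadditive E] [Linear F' E] {G : T ⥤ E}

namespace IsScalarExtension

include ht

/-- The morphisms `t(f)` span Hom(tW, tX) over `F'`. -/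
theorem linearMap_ext {M : Type*} [AddCommGroup M] [Module F' M] {W X : T}
    {φ ψ : (t.obj W ⟶ t.obj X) →ₗ[F'] M} (h : ∀ f : W ⟶ X, φ (t.map f) = ψ (t.map f)) : φ = ψ := by
  obtain ⟨κ, e, b, hb⟩ := ht.exists_basis W X
  exact b.ext fun k => by rw [hb, h]

theorem exists_lift_of_exact {S : ShortComplex C} (hS : S.Exact) {W : T} (f : t.obj W ⟶ S.X₂)
    (hf : f ≫ S.g = 0) : ∃ (V : T) (p : V ⟶ W) (_ : Epi p) (g : t.obj V ⟶ S.X₁),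
      g ≫ S.f = t.map p ≫ f := by
  have : Epi S.toCycles := hS.epi_toCycles
  obtain ⟨V, p, hp, g, hg⟩ := ht.exists_lift S.toCycles (S.liftCycles f hf)
  exact ⟨V, p, hp, g, by rw [← S.toCycles_i, ← Category.assoc, hg, Category.assoc,
    S.liftCycles_i]⟩

end IsScalarExtension

variable (F' t G) in
/-- Natural families of linear maps `Hom(t(W), X) → Hom(G(W), Y)`. -/
structure Family (X : C) (Y : E) where
  /-- the linear maps of the family -/
  app (W : T) : (t.obj W ⟶ X) →ₗ[F'] (G.obj W ⟶ Y)
  naturality {V W : T} (h : V ⟶ W) (f : t.obj W ⟶ X) :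
    app V (t.map h ≫ f) = G.map h ≫ app W f

namespace Family

variable {X : C} {Y Y' : E}

/-- Composition of a family with a morphism on the right. -/
def comp (φ : Family F' t G X Y) (u : Y ⟶ Y') : Family F' t G X Y' where
  app W := Linear.rightComp F' _ u ∘ₗ φ.app W
  naturality h f := by
    simp [φ.naturality]

theorem comp_app (φ : Family F' t G X Y) (u : Y ⟶ Y') {W : T} (f : t.obj W ⟶ X) :
    (φ.comp u).app W f = φ.app W f ≫ u := rfl

/-- Restriction of a family along a morphism. -/
def restrict {X' : C} (φ : Family F' t G X Y) (k : X' ⟶ X) : Family F' t G X' Y where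
  app W := φ.app W ∘ₗ Linear.rightComp F' _ k
  naturality h f := by
    simp [φ.naturality]

theorem restrict_app {X' : C} (φ : Family F' t G X Y) (k : X' ⟶ X) {W : T} (f : t.obj W ⟶ X') :
    (φ.restrict k).app W f = φ.app W (f ≫ k) := rfl

/-- A family is universal if every family factors through it in a unique way. -/
def IsUniversal (φ : Family F' t G X Y) : Prop :=
  ∀ (Y' : E) (ψ : Family F' t G X Y'), ∃! u : Y ⟶ Y', ∀ (W : T) (f : t.obj W ⟶ X),
    φ.app W f ≫ u = ψ.app W f

namespace IsUniversal

variable {φ : Family F' t G X Y} (hφ : φ.IsUniversal)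

/-- The morphism through which a family factors. -/
noncomputable def desc (ψ : Family F' t G X Y') : Y ⟶ Y' := (hφ Y' ψ).choose

theorem fac (ψ : Family F' t G X Y') {W : T} (f : t.obj W ⟶ X) :
    φ.app W f ≫ hφ.desc ψ = ψ.app W f :=
  (hφ Y' ψ).choose_spec.1 W f

include hφ in
theorem hom_ext {u u' : Y ⟶ Y'} (h : ∀ (W : T) (f : t.obj W ⟶ X), φ.app W f ≫ u = φ.app W f ≫ u') :
    u = u' :=
  (hφ Y' (φ.comp u')).unique h fun _ _ => rfl

end IsUniversal

include ht in
/-- A family that vanishes on the kernel of an epimorphism descends. -/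
theorem exists_descent (hG : IsRexLinear F F' G) {X Z : C} (q : X ⟶ Z) [Epi q]
    (φ : Family F' t G X Y) (hφ : ∀ (W : T) (f : t.obj W ⟶ X), f ≫ q = 0 → φ.app W f = 0) :
    ∃ ψ : Family F' t G Z Y, ∀ (W : T) (f : t.obj W ⟶ X), ψ.app W (f ≫ q) = φ.app W f := by
  have := ht.rex.additive
  have := hG.additive
  -- The value of the descended family at `h` is found by lifting `h` to `X` on a cover of `W`; it
  -- is characterized by all such local lifts at once.
  have key : ∀ (W : T) (h : t.obj W ⟶ Z), ∃ k : G.obj W ⟶ Y, ∀ (V : T) (p : V ⟶ W)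
      (g : t.obj V ⟶ X), g ≫ q = t.map p ≫ h → G.map p ≫ k = φ.app V g := by
    intro W h
    obtain ⟨V, p, hp, g, hg⟩ := ht.exists_lift q h
    -- `G.map p` is the cokernel of the image of the kernel of `p`, and `φ.app V g` vanishes on that
    -- kernel because the restriction of `g` to it is killed by `q`.
    have hc := hG.mapIsColimit (Abelian.epiIsCokernelOfKernel _ (kernelIsKernel p))
    obtain ⟨k, hk⟩ := CokernelCofork.IsColimit.desc' hc (φ.app V g) (by
      rw [← φ.naturality]
      refine hφ _ _ ?_
      rw [Category.assoc, hg, ← Category.assoc, ← t.map_comp]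
      simp)
    replace hk : G.map p ≫ k = φ.app V g := hk
    refine ⟨k, fun V' p' g' hg' => ?_⟩
    -- Two local lifts are compared on the fibre product of their covers, where their difference is
    -- killed by `q`.
    have := hG.map_epi (pullback.snd p p')
    rw [← cancel_epi (G.map (pullback.snd p p')), ← Category.assoc, ← G.map_comp,
      ← pullback.condition, G.map_comp, Category.assoc, hk, ← φ.naturality, ← φ.naturality,
      ← sub_eq_zero, ← map_sub]
    refine hφ _ _ ?_
    rw [Preadditive.sub_comp, Category.assoc, hg, Category.assoc, hg', ← Category.assoc,
      ← Category.assoc, ← t.map_comp, ← t.map_comp, pullback.condition, sub_self]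
  choose k hk using key
  refine ⟨{ app := fun W => { toFun := k W, map_add' := fun h₁ h₂ => ?_, map_smul' := fun c h => ?_ }
            naturality := fun {V W} h f => ?_ }, fun W f => ?_⟩
  · obtain ⟨V₁, p₁, _, g₁, hg₁⟩ := ht.exists_lift q h₁
    -- Lifting `h₂` only after restriction to `V₁` produces a common cover for both summands.
    obtain ⟨V₂, p₂, _, g₂, hg₂⟩ := ht.exists_lift q (t.map p₁ ≫ h₂)
    have := hG.map_epi (p₂ ≫ p₁)
    rw [← cancel_epi (G.map (p₂ ≫ p₁)), Preadditive.comp_add,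
      hk W (h₁ + h₂) V₂ (p₂ ≫ p₁) (t.map p₂ ≫ g₁ + g₂) (by simp [hg₁, hg₂]),
      hk W h₁ V₂ (p₂ ≫ p₁) (t.map p₂ ≫ g₁) (by simp [hg₁]),
      hk W h₂ V₂ (p₂ ≫ p₁) g₂ (by simp [hg₂]), map_add]
  · obtain ⟨V, p, _, g, hg⟩ := ht.exists_lift q h
    have := hG.map_epi p
    rw [← cancel_epi (G.map p), hk W (c • h) V p (c • g) (by simp [hg]), RingHom.id_apply,
      Linear.comp_smul, hk W h V p g hg, map_smul]
  · obtain ⟨V', p, _, g, hg⟩ := ht.exists_lift q (t.map h ≫ f)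
    have := hG.map_epi p
    change k V (t.map h ≫ f) = G.map h ≫ k W f
    rw [← cancel_epi (G.map p), hk V (t.map h ≫ f) V' p g hg, ← Category.assoc, ← G.map_comp,
      hk W f V' (p ≫ h) g (by simp [hg])]
  · change k W (f ≫ q) = _
    rw [← Category.id_comp (k W (f ≫ q)), ← G.map_id]
    exact hk W (f ≫ q) W (𝟙 W) f (by simp)

include ht in
theorem ext_of_epi (hG : IsRexLinear F F' G) {X Z : C} (q : X ⟶ Z) [Epi q]
    {φ ψ : Family F' t G Z Y} (h : ∀ (W : T) (f : t.obj W ⟶ X), φ.app W (f ≫ q) = ψ.app W (f ≫ q))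
    (W : T) (f : t.obj W ⟶ Z) : φ.app W f = ψ.app W f := by
  obtain ⟨V, p, _, g, hg⟩ := ht.exists_lift q f
  have := hG.map_epi p
  rw [← cancel_epi (G.map p), ← φ.naturality, ← ψ.naturality, ← hg, h]

end Family

end Families


/-! ### Presentations and existence of universal families -/

section ExtensionOnMorphisms

variable {F F' : Type*} [Field F] [Field F'] [Algebra F F'] {T : Type u}
  [Category.{v} T] [Abelian T] [Linear F T] {C : Type*} [Category* C] [Abelian C]
  [Linear F' C] {t : T ⥤ C} (ht : IsScalarExtension F F' t)
  {E : Type*} [Category* E] [Preadditive E] [Linear F' E] (G : T ⥤ E)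

namespace IsScalarExtension

/-- The linear map `Hom(t(W), t(X)) → Hom(G(W), G(X))` with `t(f) ↦ G(f)`. -/
noncomputable def ext (W X : T) : (t.obj W ⟶ t.obj X) →ₗ[F'] (G.obj W ⟶ G.obj X) :=
  (ht.exists_basis W X).choose_spec.choose_spec.choose.constr F' fun k =>
    G.map ((ht.exists_basis W X).choose_spec.choose k)

variable {G} (hG : IsRexLinear F F' G)

include hG

/-- Both sides are additive and semilinear in `f` and agree on the chosen basis, so `ext` does not
depend on that basis. -/
theorem ext_map {W X : T} (f : W ⟶ X) : ht.ext G W X (t.map f) = G.map f := by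
  have := hG.additive
  have := ht.rex.additive
  let e := (ht.exists_basis W X).choose_spec.choose
  have hf : f ∈ Submodule.span F (Set.range e) := by simp
  induction hf using Submodule.span_induction with
  | mem x h =>
    obtain ⟨k, rfl⟩ := h
    rw [← (ht.exists_basis W X).choose_spec.choose_spec.choose_spec k]
    exact Module.Basis.constr_basis _ _ _ _
  | zero => simp
  | add x y _ _ hx hy => rw [t.map_add, map_add, hx, hy, G.map_add]
  | smul c x _ hx => rw [ht.rex.map_smul, map_smul, hx, hG.map_smul]

theorem ext_map_comp {V W X : T} (h : V ⟶ W) (f : t.obj W ⟶ t.obj X) :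
    ht.ext G V X (t.map h ≫ f) = G.map h ≫ ht.ext G W X f := by
  have : ht.ext G V X ∘ₗ Linear.leftComp F' _ (t.map h) =
      Linear.leftComp F' _ (G.map h) ∘ₗ ht.ext G W X :=
    ht.linearMap_ext fun f => by
      change ht.ext G V X (t.map h ≫ t.map f) = G.map h ≫ ht.ext G W X (t.map f)
      rw [← t.map_comp, ht.ext_map hG, ht.ext_map hG, G.map_comp]
  exact LinearMap.congr_fun this f

end IsScalarExtension

variable {G} (hG : IsRexLinear F F' G)

namespace Family

/-- The universal family for `X = t(P)`. -/
noncomputable def ofExt (P : T) : Family F' t G (t.obj P) (G.obj P) where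
  app W := ht.ext G W P
  naturality h f := ht.ext_map_comp hG h f

variable {P : T} {X : C} {Y : E}

include hG in
-- A Yoneda lemma for families: on morphisms through `p` a family is determined by its value at `p`.
-- By linearity it suffices to treat `t.map f`, where it is naturality.
theorem app_comp (φ : Family F' t G X Y) (p : t.obj P ⟶ X) {W : T} (f : t.obj W ⟶ t.obj P) :
    φ.app W (f ≫ p) = ht.ext G W P f ≫ φ.app P p := by
  have : φ.app W ∘ₗ Linear.rightComp F' _ p =
      Linear.rightComp F' _ (φ.app P p) ∘ₗ ht.ext G W P :=
    ht.linearMap_ext fun f => by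
      change φ.app W (t.map f ≫ p) = ht.ext G W P (t.map f) ≫ φ.app P p
      rw [ht.ext_map hG, φ.naturality]
  exact LinearMap.congr_fun this f

end Family

variable (t) in
/-- A presentation `t(R) ⟶ t(P) ⟶ X ⟶ 0` of an object. -/
structure Presentation (X : C) where
  {P : T}
  {R : T}
  /-- the epimorphism onto `X` -/
  p : t.obj P ⟶ X
  /-- the morphism onto the kernel of `p` -/
  r : t.obj R ⟶ t.obj P
  w : r ≫ p = 0
  exact : (ShortComplex.mk r p w).Exact
  epi : Epi p

include ht in
theorem IsScalarExtension.nonempty_presentation (X : C) : Nonempty (Presentation t X) := by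
  obtain ⟨P, p, hp⟩ := ht.exists_cover X
  obtain ⟨R, r, hr⟩ := ht.exists_cover (kernel p)
  refine ⟨⟨p, r ≫ kernel.ι p, by simp, ?_, hp⟩⟩
  rw [ShortComplex.exact_iff_epi_kernel_lift]
  convert hr
  rw [← cancel_mono (kernel.ι p)]
  simp

namespace Family

variable {X : C} {Y : E} (pr : Presentation t X)

include hG in
theorem ext_comp_app (φ : Family F' t G X Y) :
    ht.ext G pr.R pr.P pr.r ≫ φ.app pr.P pr.p = 0 := by
  rw [← φ.app_comp ht hG, pr.w, map_zero]

include hG in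
/-- A family is universal if it presents its target by means of a presentation of `X`. -/
theorem isUniversal_of_isColimit (φ : Family F' t G X Y)
    (h : IsColimit (CokernelCofork.ofπ _ (φ.ext_comp_app ht hG pr))) : φ.IsUniversal := by
  intro Y' ψ
  obtain ⟨u, hu⟩ := CokernelCofork.IsColimit.desc' h _ (ψ.ext_comp_app ht hG pr)
  replace hu : φ.app pr.P pr.p ≫ u = ψ.app pr.P pr.p := hu
  refine ⟨u, fun W f => ?_, fun u' hu' => Cofork.IsColimit.hom_ext h ((hu' _ _).trans hu.symm)⟩
  have := pr.epi
  refine ext_of_epi ht hG pr.p (φ := φ.comp u) (fun W f => ?_) W f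
  rw [comp_app, φ.app_comp ht hG, ψ.app_comp ht hG, Category.assoc, hu]

include ht in
/-- The family of the maps `Hom(t(W), X) → Hom(H(t(W)), H(X))` is universal. -/
theorem isUniversal_of_isRexLinear {H : C ⥤ E} (hH : IsRexLinear F' F' H) (X : C)
    (φ : Family F' t (t ⋙ H) X (H.obj X)) (hφ : ∀ (W : T) (f : t.obj W ⟶ X), φ.app W f = H.map f) :
    φ.IsUniversal := by
  obtain ⟨pr⟩ := ht.nonempty_presentation X
  have hG : IsRexLinear F F' (t ⋙ H) := ht.rex.comp hH
  have := hH.additive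
  have := pr.epi
  -- `H` and `ext` agree on morphisms between objects of the form t(W), by linearity. Thus the image
  -- of the presentation under `H` is the one that tests universality.
  have hr : ht.ext (t ⋙ H) pr.R pr.P pr.r = H.map pr.r := by
    let ψ : (t.obj pr.R ⟶ t.obj pr.P) →ₗ[F'] (H.obj (t.obj pr.R) ⟶ H.obj (t.obj pr.P)) :=
      { toFun := fun f => H.map f
        map_add' := fun f g => H.map_add
        map_smul' := fun c f => hH.map_smul c f }
    have : ht.ext (t ⋙ H) pr.R pr.P = ψ := ht.linearMap_ext fun f => ht.ext_map hG f
    exact LinearMap.congr_fun this pr.r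
  refine φ.isUniversal_of_isColimit ht hG pr (IsColimit.ofIsoColimit
    (isCokernelEpiComp (hH.mapIsColimit pr.exact.gIsCokernel) (𝟙 _) ?_) 
    (Cofork.ext (Iso.refl _) ?_))
  · rw [Category.id_comp]
    exact hr
  · exact (Category.comp_id _).trans (hφ _ _).symm

variable [HasCokernels E]

include ht hG in
/-- Universal families exist. -/
theorem exists_isUniversal (X : C) :
    ∃ (Y : E) (φ : Family F' t G X Y), φ.IsUniversal := by
  obtain ⟨pr⟩ := ht.nonempty_presentation X
  have := pr.epi
  -- The target is the cokernel of the morphism G(R) ⟶ G(P) induced by `pr.r`. By exactness a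
  -- morphism to t(P) killed by `pr.p` comes from t(R) on a cover, so its value dies in this
  -- cokernel.
  obtain ⟨φ, hφ⟩ := exists_descent ht hG pr.p
    ((ofExt ht hG pr.P).comp (cokernel.π (ht.ext G pr.R pr.P pr.r))) (fun W f hf => by
      obtain ⟨V, q, _, g, hg⟩ := ht.exists_lift_of_exact pr.exact f hf
      have := hG.map_epi q
      rw [← cancel_epi (G.map q), ← naturality, comp_zero, ← hg, comp_app, app_comp ht hG,
        Category.assoc]
      exact (congrArg _ (cokernel.condition _)).trans comp_zero)
  have hp : φ.app pr.P pr.p = cokernel.π (ht.ext G pr.R pr.P pr.r) := by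
    have := hφ pr.P (𝟙 _)
    rw [Category.id_comp] at this
    rw [this, comp_app]
    change ht.ext G _ _ (𝟙 _) ≫ _ = _
    rw [← t.map_id, ht.ext_map hG, G.map_id, Category.id_comp]
  exact ⟨_, φ, φ.isUniversal_of_isColimit ht hG pr (IsColimit.ofIsoColimit
    (cokernelIsCokernel _) (Cofork.ext (Iso.refl _) ((Category.comp_id _).trans hp.symm)))⟩

end Family

end ExtensionOnMorphisms


/-! ### Extension of right exact functors to the scalar extension -/

section ExtensionFunctor

variable {F F' : Type*} [Field F] [Field F'] [Algebra F F'] {T : Type u}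
  [Category.{v} T] [Abelian T] [Linear F T] {C : Type*} [Category* C] [Abelian C]
  [Linear F' C] {t : T ⥤ C} (ht : IsScalarExtension F F' t)
  {E : Type*} [Category* E] [Preadditive E] [Linear F' E] {G : T ⥤ E}

variable (F' t G) in
/-- A functor with a functorial system of universal families. -/
structure UniversalSystem (H : C ⥤ E) where
  /-- the families -/
  family (X : C) : Family F' t G X (H.obj X)
  isUniversal (X : C) : (family X).IsUniversal
  app_map {X Y : C} (k : X ⟶ Y) {W : T} (f : t.obj W ⟶ X) :
    (family X).app W f ≫ H.map k = (family Y).app W (f ≫ k)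

include ht in
-- Choosing a universal family for each object suffices: universality defines the action on
-- morphisms and forces functoriality.
theorem exists_universalSystem [HasCokernels E] (hG : IsRexLinear F F' G) :
    ∃ H : C ⥤ E, Nonempty (UniversalSystem F' t G H) := by
  choose Y Φ hΦ using fun X : C => Family.exists_isUniversal ht hG X
  exact ⟨{
      obj := Y
      map := fun {X Y} f => (hΦ X).desc ((Φ Y).restrict f)
      map_id := fun X => (hΦ X).hom_ext fun W f => by
        rw [(hΦ X).fac, Family.restrict_app, Category.comp_id, Category.comp_id]
      map_comp := fun {X Y Z} g h => (hΦ X).hom_ext fun W f => by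
        rw [← Category.assoc, (hΦ X).fac, (hΦ X).fac, Family.restrict_app,
          Family.restrict_app, (hΦ Y).fac, Family.restrict_app, Category.assoc] },
    ⟨⟨Φ, hΦ, fun {X Y} k W f => (hΦ X).fac _ f⟩⟩⟩

namespace UniversalSystem

variable {H : C ⥤ E} (S : UniversalSystem F' t G H)

include S

theorem additive : H.Additive where
  map_add {X Y f g} := (S.isUniversal X).hom_ext fun W k => by
    rw [S.app_map, Preadditive.comp_add, Preadditive.comp_add, map_add, S.app_map, S.app_map]

include ht in
-- A morphism from H(Y) killed by H(f) corresponds to a family on `Y` that vanishes on the kernel of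
-- `cokernel.π f`; such a family descends.
theorem exists_isColimit (hG : IsRexLinear F F' G) {X Y : C} (f : X ⟶ Y) :
    ∃ w : H.map f ≫ H.map (cokernel.π f) = 0,
      Nonempty (IsColimit (CokernelCofork.ofπ (H.map (cokernel.π f)) w)) := by
  have := S.additive
  have hepi : Epi (H.map (cokernel.π f)) := by
    refine Preadditive.epi_of_cancel_zero _ fun {Z} u hu =>
      (S.isUniversal _).hom_ext fun W k => ?_
    obtain ⟨V, q, _, g, hg⟩ := ht.exists_lift (cokernel.π f) k
    have := hG.map_epi q
    rw [← cancel_epi (G.map q), ← Category.assoc, ← Family.naturality, ← hg, ← S.app_map,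
      Category.assoc, hu, comp_zero, comp_zero, comp_zero]
  refine ⟨by rw [← Functor.map_comp, cokernel.condition, Functor.map_zero],
    ⟨CokernelCofork.IsColimit.ofπ' _ _ fun {A} k hk => Nonempty.some ?_⟩⟩
  obtain ⟨ψ, hψ⟩ := Family.exists_descent ht hG (cokernel.π f) ((S.family Y).comp k)
    (fun W g hg => by
      obtain ⟨V, q, _, l, hl⟩ := ht.exists_lift_of_exact
        (ShortComplex.exact_of_g_is_cokernel (.mk f (cokernel.π f) (cokernel.condition f))
          (cokernelIsCokernel f)) g hg
      have := hG.map_epi q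
      rw [← cancel_epi (G.map q), ← Family.naturality, ← hl, Family.comp_app,
        ← S.app_map, Category.assoc, hk, comp_zero, comp_zero])
  refine ⟨(S.isUniversal _).desc ψ, (S.isUniversal _).hom_ext fun W g => ?_⟩
  rw [← Category.assoc, S.app_map, Family.IsUniversal.fac, hψ, Family.comp_app]

include ht in
theorem isRexLinear (hG : IsRexLinear F F' G) [HasZeroObject E] : IsRexLinear F' F' H where
  additive := S.additive
  map_smul {X Y} c f := (S.isUniversal X).hom_ext fun W k => by
    rw [S.app_map, Algebra.algebraMap_self, RingHom.id_apply, Linear.comp_smul,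
      Linear.comp_smul, map_smul, S.app_map]
  rightExact := by
    have := S.additive
    have {X Y : C} (f : X ⟶ Y) : PreservesColimit (parallelPair f 0) H := by
      obtain ⟨w, ⟨h⟩⟩ := S.exists_isColimit ht hG f
      exact preservesColimit_of_preserves_colimit_cocone (cokernelIsCokernel f)
        ((CokernelCofork.isColimitMapCoconeEquiv _ _).symm h)
    exact Functor.preservesFiniteColimits_of_preservesCokernels _

/-- The extended functor extends the given functor. -/
noncomputable def iso (hG : IsRexLinear F F' G) : t ⋙ H ≅ G :=
  NatIso.ofComponents
    (fun X => show H.obj (t.obj X) ≅ G.obj X from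
      { hom := (S.isUniversal (t.obj X)).desc (Family.ofExt ht hG X)
        inv := (S.family (t.obj X)).app X (𝟙 _)
        hom_inv_id := (S.isUniversal _).hom_ext fun W f => by
          rw [← Category.assoc, Family.IsUniversal.fac]
          refine (Family.app_comp ht hG _ _ _).symm.trans ?_
          rw [Category.comp_id]
          exact (Category.comp_id _).symm
        inv_hom_id := by
          rw [Family.IsUniversal.fac]
          change ht.ext G X X (𝟙 _) = _
          rw [← t.map_id, ht.ext_map hG, G.map_id] })
    (fun {X Y} f => (S.isUniversal _).hom_ext fun W k => by
      change _ ≫ H.map (t.map f) ≫ (S.isUniversal (t.obj Y)).desc (Family.ofExt ht hG Y) =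
        _ ≫ (S.isUniversal (t.obj X)).desc (Family.ofExt ht hG X) ≫ G.map f
      rw [← Category.assoc, ← Category.assoc, S.app_map, Family.IsUniversal.fac,
        Family.IsUniversal.fac, ← ht.ext_map hG f]
      exact Family.app_comp ht hG (Family.ofExt ht hG Y) _ _)

end UniversalSystem

include ht in
/-- Right exact linear functors extend to the scalar extension. -/
theorem exists_extension [HasCokernels E] [HasZeroObject E] (hG : IsRexLinear F F' G) :
    ∃ H : C ⥤ E, IsRexLinear F' F' H ∧ Nonempty (t ⋙ H ≅ G) := by
  obtain ⟨H, ⟨S⟩⟩ := exists_universalSystem ht hG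
  exact ⟨H, S.isRexLinear ht hG, ⟨S.iso ht hG⟩⟩

end ExtensionFunctor

/-! ### Extension of natural transformations -/

section ExtensionOfTransformations

variable {F F' : Type*} [Field F] [Field F'] [Algebra F F'] {T : Type u}
  [Category.{v} T] [Abelian T] [Linear F T] {C : Type*} [Category* C] [Abelian C]
  [Linear F' C] {t : T ⥤ C} (ht : IsScalarExtension F F' t)
  {E : Type*} [Category* E] [Preadditive E] [Linear F' E] {H₁ H₂ : C ⥤ E}
  (h₁ : IsRexLinear F' F' H₁) (h₂ : IsRexLinear F' F' H₂)

/-- The family attached to a functor on the scalar extension. -/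
def mapFamily {H : C ⥤ E} (h : IsRexLinear F' F' H) (X : C) :
    Family F' t (t ⋙ H) X (H.obj X) where
  app _ :=
    { toFun := fun f => H.map f
      map_add' := fun _ _ => have := h.additive; H.map_add
      map_smul' := fun c f => h.map_smul c f }
  naturality _ _ := H.map_comp _ _

/-- The family attached to a functor on the scalar extension and a natural transformation. -/
def transFamily {H₁ H₂ : C ⥤ E} (h : IsRexLinear F' F' H₂) (τ : t ⋙ H₁ ⟶ t ⋙ H₂) (X : C) :
    Family F' t (t ⋙ H₁) X (H₂.obj X) where
  app W := Linear.leftComp F' _ (τ.app W) ∘ₗ (mapFamily h X).app W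
  naturality {V W} p f := by
    change τ.app V ≫ H₂.map (t.map p ≫ f) = H₁.map (t.map p) ≫ τ.app W ≫ H₂.map f
    have := τ.naturality p
    dsimp at this
    rw [H₂.map_comp, reassoc_of% this]

include ht h₁ in
-- Every object is a quotient of some t(W), and `H₁` preserves that epimorphism.
theorem natTrans_ext {σ σ' : H₁ ⟶ H₂} (h : ∀ X, σ.app (t.obj X) = σ'.app (t.obj X)) : σ = σ' := by
  ext X
  obtain ⟨W, p, _⟩ := ht.exists_cover X
  have := h₁.map_epi p
  rw [← cancel_epi (H₁.map p), σ.naturality, σ'.naturality, h]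

include ht h₁ h₂ in
/-- Natural transformations extend from `T` to its scalar extension. -/
theorem exists_natTrans (τ : t ⋙ H₁ ⟶ t ⋙ H₂) :
    ∃ σ : H₁ ⟶ H₂, ∀ X, σ.app (t.obj X) = τ.app X := by
  -- Morphisms from `H₁.obj X` are the families on `X` for `t ⋙ H₁`, and f ↦ τ_W ≫ H₂(f) is one of
  -- them.
  have hu (X : C) : (mapFamily (t := t) h₁ X).IsUniversal :=
    Family.isUniversal_of_isRexLinear ht h₁ X _ fun _ _ => rfl
  have hfac (X : C) {W : T} (f : t.obj W ⟶ X) :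
      H₁.map f ≫ (hu X).desc (transFamily h₂ τ X) = τ.app W ≫ H₂.map f :=
    (hu X).fac (transFamily h₂ τ X) f
  refine ⟨{ app := fun X => (hu X).desc (transFamily h₂ τ X)
            naturality := fun X Y k => (hu X).hom_ext fun W f => ?_ }, fun X => ?_⟩
  · change H₁.map f ≫ _ = H₁.map f ≫ _
    rw [reassoc_of% hfac X f, ← Functor.map_comp_assoc, hfac, Functor.map_comp]
  · have := hfac (t.obj X) (𝟙 _)
    simpa using this

end ExtensionOfTransformations


/-! ### Right exact functors with values in functor categories -/

section Evaluation

variable {R S : Type*} [Field R] [Field S] [Algebra R S] {D E J : Type*} [Category* D]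
  [Category* E] [Category* J] [Preadditive D] [Preadditive E] [Linear R D] [Linear S E]

theorem isRexLinear_of_evaluation {G : D ⥤ J ⥤ E} (h : ∀ j, IsRexLinear R S (G.flip.obj j)) :
    IsRexLinear R S G where
  additive := ⟨fun {X Y f g} => by
    ext j
    have := (h j).additive
    exact (G.flip.obj j).map_add⟩
  map_smul c f := by
    ext j
    exact (h j).map_smul c f
  rightExact := ⟨fun K _ _ => preservesColimitsOfShape_of_evaluation _ _ fun j =>
    have := (h j).rightExact
    inferInstanceAs (PreservesColimitsOfShape K (G.flip.obj j))⟩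

theorem IsRexLinear.flip_obj [HasFiniteColimits E] {G : D ⥤ J ⥤ E} (h : IsRexLinear R S G)
    (j : J) : IsRexLinear R S (G.flip.obj j) where
  additive := ⟨fun {X Y f g} => by
    have := h.additive
    exact (congrArg (fun k => k.app j) (G.map_add (f := f) (g := g)))⟩
  map_smul c f := congrArg (fun k => k.app j) (h.map_smul c f)
  rightExact :=
    have := h.rightExact
    have : PreservesFiniteColimits ((evaluation J E).obj j) := ⟨fun _ _ _ => inferInstance⟩
    comp_preservesFiniteColimits G ((evaluation J E).obj j)

/-- Colimits commute with colimits, so a cokernel of right exact functors is right exact. Additivity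
and linearity pass along the pointwise epimorphism `b`. -/
theorem IsRexLinear.of_isColimit [HasFiniteColimits E] {G₁ G₂ G₃ : D ⥤ E} {a : G₁ ⟶ G₂}
    {b : G₂ ⟶ G₃} {w : a ≫ b = 0} (h : IsColimit (CokernelCofork.ofπ b w))
    (h₁ : IsRexLinear R S G₁) (h₂ : IsRexLinear R S G₂) : IsRexLinear R S G₃ := by
  have : Epi b := Cofork.IsColimit.epi h
  exact
  { additive := ⟨fun {X Y f g} => by
      have := h₂.additive
      rw [← cancel_epi (b.app X), ← b.naturality, G₂.map_add, Preadditive.add_comp,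
        b.naturality, b.naturality, Preadditive.comp_add]⟩
    map_smul := fun {X Y} c f => by
      rw [← cancel_epi (b.app X), ← b.naturality, h₂.map_smul, Linear.smul_comp,
        b.naturality, Linear.comp_smul]
    rightExact := by
      have := h₁.rightExact
      have := h₂.rightExact
      have : PreservesFiniteColimits (parallelPair a 0).flip :=
        preservesFiniteColimits_of_evaluation _ (by
          rintro (_ | _)
          · exact inferInstanceAs (PreservesFiniteColimits G₁)
          · exact inferInstanceAs (PreservesFiniteColimits G₂))
      have : PreservesFiniteColimits ((parallelPair a 0).flip ⋙ colim) :=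
        comp_preservesFiniteColimits _ _
      exact preservesFiniteColimits_of_natIso ((colimitIsoFlipCompColim _).symm ≪≫
        (colimit.isColimit _).coconePointUniqueUpToIso h) }

end Evaluation

/-! ### Extension of bifunctors -/

section Bifunctors

/-- Functors of two variables that are right exact and linear in each variable. -/
structure IsBirexLinear (R₁ R₂ S : Type*) [Field R₁] [Field R₂] [Field S] [Algebra R₁ S]
    [Algebra R₂ S] {D₁ D₂ E : Type*} [Category* D₁] [Category* D₂]
    [Category* E] [Preadditive D₁] [Preadditive D₂] [Preadditive E] [Linear R₁ D₁] [Linear R₂ D₂]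
    [Linear S E] (B : D₁ ⥤ D₂ ⥤ E) : Prop where
  right (X : D₁) : IsRexLinear R₂ S (B.obj X)
  left (Y : D₂) : IsRexLinear R₁ S (B.flip.obj Y)

namespace IsBirexLinear

variable {R₁ R₂ S : Type*} [Field R₁] [Field R₂] [Field S] [Algebra R₁ S]
    [Algebra R₂ S] {D₁ D₂ E : Type*} [Category* D₁] [Category* D₂]
    [Category* E] [Preadditive D₁] [Preadditive D₂] [Preadditive E] [Linear R₁ D₁] [Linear R₂ D₂]
    [Linear S E] {B B' : D₁ ⥤ D₂ ⥤ E}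

theorem rex (h : IsBirexLinear R₁ R₂ S B) : IsRexLinear R₁ S B := isRexLinear_of_evaluation h.left

theorem flip (h : IsBirexLinear R₁ R₂ S B) : IsBirexLinear R₂ R₁ S B.flip := ⟨h.left, h.right⟩

theorem of_iso (h : IsBirexLinear R₁ R₂ S B) (e : B ≅ B') : IsBirexLinear R₁ R₂ S B' :=
  ⟨fun X => (h.right X).of_iso (e.app X),
    fun Y => (h.left Y).of_iso (((flipFunctor _ _ _).mapIso e).app Y)⟩

end IsBirexLinear

variable {F F' : Type*} [Field F] [Field F'] [Algebra F F'] {T : Type u}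
  [Category.{v} T] [Abelian T] [Linear F T] {C : Type*} [Category* C] [Abelian C]
  [Linear F' C] {t : T ⥤ C} (ht : IsScalarExtension F F' t)
  {E : Type*} [Category* E] [Preadditive E] [Linear F' E] [HasFiniteColimits E]

section OneVariable

variable {R : Type*} [Field R] [Algebra R F'] {D : Type*} [Category* D] [Preadditive D]
  [Linear R D]

include ht

/-- A presentation of `X` exhibits `B.obj X` as a cokernel of functors for which the claim is
assumed. -/
theorem isRexLinear_obj {B : C ⥤ D ⥤ E} (hB : IsRexLinear F' F' B)
    (h : ∀ P, IsRexLinear R F' (B.obj (t.obj P))) (X : C) : IsRexLinear R F' (B.obj X) := by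
  obtain ⟨pr⟩ := ht.nonempty_presentation X
  have := pr.epi
  exact .of_isColimit (hB.mapIsColimit pr.exact.gIsCokernel) (h _) (h _)

/-- Extension of bifunctors in one variable. -/
theorem exists_extension_left [HasZeroObject E] {B₀ : T ⥤ D ⥤ E} (h : IsBirexLinear F R F' B₀) :
    ∃ B : C ⥤ D ⥤ E, IsBirexLinear F' R F' B ∧ Nonempty (t ⋙ B ≅ B₀) := by
  obtain ⟨B, hB, ⟨e⟩⟩ := exists_extension ht h.rex
  exact ⟨B, ⟨isRexLinear_obj ht hB fun P => (h.right P).of_iso (e.symm.app P),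
    hB.flip_obj⟩, ⟨e⟩⟩

end OneVariable

include ht in
/-- Extension of bifunctors in both variables. -/
theorem exists_extension₂ [HasZeroObject E] {B₀ : T ⥤ T ⥤ E} (h : IsBirexLinear F F F' B₀) :
    ∃ B : C ⥤ C ⥤ E, IsBirexLinear F' F' F' B ∧
      ∃ m : ∀ X Y, (B.obj (t.obj X)).obj (t.obj Y) ≅ (B₀.obj X).obj Y,
        (∀ {X X' : T} (f : X ⟶ X') (Y : T), (B.map (t.map f)).app (t.obj Y) ≫ (m X' Y).hom =
          (m X Y).hom ≫ (B₀.map f).app Y) ∧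
        ∀ (X : T) {Y Y' : T} (f : Y ⟶ Y'), (B.obj (t.obj X)).map (t.map f) ≫ (m X Y').hom =
          (m X Y).hom ≫ (B₀.obj X).map f := by
  -- The first variable is extended first; after a flip the same result extends the other one.
  obtain ⟨B₁, h₁, ⟨e₁⟩⟩ := exists_extension_left ht h
  obtain ⟨B₂, h₂, ⟨e₂⟩⟩ := exists_extension_left ht h₁.flip
  refine ⟨B₂.flip, h₂.flip, fun X Y => (e₂.app Y).app (t.obj X) ≪≫ (e₁.app X).app Y,
    fun f Y => ?_, fun X Y Y' f => ?_⟩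
  · have n₂ := (e₂.hom.app Y).naturality (t.map f)
    have n₁ := congrArg (fun k => k.app Y) (e₁.hom.naturality f)
    dsimp at n₁ n₂ ⊢
    rw [reassoc_of% n₂, n₁, Category.assoc]
  · have n₂ := congrArg (fun k => k.app (t.obj X)) (e₂.hom.naturality f)
    have n₁ := (e₁.hom.app X).naturality f
    dsimp at n₁ n₂ ⊢
    rw [reassoc_of% n₂, n₁, Category.assoc]

end Bifunctors


/-! ### Transformations of functors of two variables -/

section TransformationsOfBifunctors

variable {F F' : Type*} [Field F] [Field F'] [Algebra F F'] {T : Type u}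
  [Category.{v} T] [Abelian T] [Linear F T] {C : Type*} [Category* C] [Abelian C]
  [Linear F' C] {t : T ⥤ C} (ht : IsScalarExtension F F' t)
  {E : Type*} [Category* E] [Preadditive E] [Linear F' E]

include ht

/-- The inverse of the restriction to `T` extends too, and the two composites are identities because
they are so on the objects t(X). -/
theorem isIso_of_isIso_app {H₁ H₂ : C ⥤ E} (h₁ : IsRexLinear F' F' H₁) (h₂ : IsRexLinear F' F' H₂)
    (σ : H₁ ⟶ H₂) (h : ∀ X, IsIso (σ.app (t.obj X))) : IsIso σ := by
  have : IsIso (Functor.whiskerLeft t σ) := by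
    have (X : T) : IsIso ((Functor.whiskerLeft t σ).app X) := h X
    exact NatIso.isIso_of_isIso_app _
  obtain ⟨σ', hσ'⟩ := exists_natTrans ht h₂ h₁ (inv (Functor.whiskerLeft t σ))
  refine ⟨σ', natTrans_ext ht h₁ fun X => ?_, natTrans_ext ht h₂ fun X => ?_⟩
  · rw [NatTrans.comp_app, hσ']
    exact congrArg (fun k => k.app X) (IsIso.hom_inv_id (Functor.whiskerLeft t σ))
  · rw [NatTrans.comp_app, hσ']
    exact congrArg (fun k => k.app X) (IsIso.inv_hom_id (Functor.whiskerLeft t σ))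

section TwoVariables

variable {B₁ B₂ : C ⥤ C ⥤ E} (h₁ : IsBirexLinear F' F' F' B₁) (h₂ : IsBirexLinear F' F' F' B₂)

include h₁

theorem natTrans_ext₂ {σ σ' : B₁ ⟶ B₂}
    (h : ∀ X Y, (σ.app (t.obj X)).app (t.obj Y) = (σ'.app (t.obj X)).app (t.obj Y)) : σ = σ' :=
  natTrans_ext ht h₁.rex fun X => natTrans_ext ht (h₁.right _) fun Y => h X Y

include h₂

theorem isIso_of_isIso_app₂ (σ : B₁ ⟶ B₂)
    (h : ∀ X Y, IsIso ((σ.app (t.obj X)).app (t.obj Y))) : IsIso σ :=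
  isIso_of_isIso_app ht h₁.rex h₂.rex σ fun X =>
    isIso_of_isIso_app ht (h₁.right _) (h₂.right _) _ fun Y => h X Y

/-- Natural transformations of bifunctors extend from `T` to its scalar extension. -/
theorem exists_natTrans₂ (τ : ∀ X Y, (B₁.obj (t.obj X)).obj (t.obj Y) ⟶
      (B₂.obj (t.obj X)).obj (t.obj Y))
    (nat_left : ∀ {X X' : T} (f : X ⟶ X') (Y : T), (B₁.map (t.map f)).app (t.obj Y) ≫ τ X' Y =
      τ X Y ≫ (B₂.map (t.map f)).app (t.obj Y))
    (nat_right : ∀ (X : T) {Y Y' : T} (f : Y ⟶ Y'), (B₁.obj (t.obj X)).map (t.map f) ≫ τ X Y' =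
      τ X Y ≫ (B₂.obj (t.obj X)).map (t.map f)) :
    ∃ σ : B₁ ⟶ B₂, ∀ X Y, (σ.app (t.obj X)).app (t.obj Y) = τ X Y := by
  -- With the first variable kept in `T`, the second is extended for functors with values in `T ⥤
  -- E`; then the first is extended.
  have hL (B : C ⥤ C ⥤ E) (h : IsBirexLinear F' F' F' B) :
      IsRexLinear F' F' (t ⋙ B).flip := isRexLinear_of_evaluation fun X => h.right (t.obj X)
  obtain ⟨σ₁, hσ₁⟩ := exists_natTrans ht (hL _ h₁) (hL _ h₂)
    { app := fun Y => { app := fun X => τ X Y, naturality := fun _ _ f => nat_left f Y }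
      naturality := fun _ _ f => NatTrans.ext (funext fun X => nat_right X f) }
  obtain ⟨σ, hσ⟩ := exists_natTrans ht h₁.rex h₂.rex
    { app := fun X =>
        { app := fun Y => (σ₁.app Y).app X
          naturality := fun _ _ f => congrArg (fun k => k.app X) (σ₁.naturality f) }
      naturality := fun _ _ f => NatTrans.ext (funext fun Y => (σ₁.app Y).naturality f) }
  exact ⟨σ, fun X Y => by rw [hσ]; exact congrArg (fun k => k.app X) (hσ₁ Y)⟩

end TwoVariables

end TransformationsOfBifunctors

/-! ### Transformations of functors of three variables -/

section TransformationsOfTrifunctors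

/-- Functors of three variables that are right exact and linear in each variable. -/
structure IsTrirexLinear (R : Type*) [Field R] {D E : Type*} [Category* D] [Category* E]
    [Preadditive D] [Preadditive E] [Linear R D] [Linear R E] (B : D ⥤ D ⥤ D ⥤ E) : Prop where
  left (Y Z : D) : IsRexLinear R R ((B.flip.obj Y).flip.obj Z)
  middle (X Z : D) : IsRexLinear R R ((B.obj X).flip.obj Z)
  right (X Y : D) : IsRexLinear R R ((B.obj X).obj Y)

variable {F F' : Type*} [Field F] [Field F'] [Algebra F F'] {T : Type u}
  [Category.{v} T] [Abelian T] [Linear F T] {C : Type*} [Category* C] [Abelian C]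
  [Linear F' C] {t : T ⥤ C} (ht : IsScalarExtension F F' t)
  {E : Type*} [Category* E] [Preadditive E] [Linear F' E]
  {B₁ B₂ : C ⥤ C ⥤ C ⥤ E} (h₁ : IsTrirexLinear F' B₁) (h₂ : IsTrirexLinear F' B₂)

theorem IsTrirexLinear.rex (h : IsTrirexLinear F' B₁) : IsRexLinear F' F' B₁ :=
  isRexLinear_of_evaluation fun Y => isRexLinear_of_evaluation fun Z => h.left Y Z

theorem IsTrirexLinear.obj (h : IsTrirexLinear F' B₁) (X : C) :
    IsBirexLinear F' F' F' (B₁.obj X) :=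
  ⟨h.right X, h.middle X⟩

include ht h₁ h₂

theorem isIso_of_isIso_app₃ (σ : B₁ ⟶ B₂)
    (h : ∀ X Y Z, IsIso (((σ.app (t.obj X)).app (t.obj Y)).app (t.obj Z))) : IsIso σ :=
  isIso_of_isIso_app ht h₁.rex h₂.rex σ fun X =>
    isIso_of_isIso_app₂ ht (h₁.obj _) (h₂.obj _) _ fun Y Z => h X Y Z

/-- Natural transformations of functors of three variables extend from `T` to its scalar
extension. -/
theorem exists_natTrans₃ (τ : ∀ X Y Z, ((B₁.obj (t.obj X)).obj (t.obj Y)).obj (t.obj Z) ⟶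
      ((B₂.obj (t.obj X)).obj (t.obj Y)).obj (t.obj Z))
    (nat_left : ∀ {X X' : T} (f : X ⟶ X') (Y Z : T),
      ((B₁.map (t.map f)).app (t.obj Y)).app (t.obj Z) ≫ τ X' Y Z =
        τ X Y Z ≫ ((B₂.map (t.map f)).app (t.obj Y)).app (t.obj Z))
    (nat_middle : ∀ (X : T) {Y Y' : T} (f : Y ⟶ Y') (Z : T),
      ((B₁.obj (t.obj X)).map (t.map f)).app (t.obj Z) ≫ τ X Y' Z =
        τ X Y Z ≫ ((B₂.obj (t.obj X)).map (t.map f)).app (t.obj Z))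
    (nat_right : ∀ (X Y : T) {Z Z' : T} (f : Z ⟶ Z'),
      ((B₁.obj (t.obj X)).obj (t.obj Y)).map (t.map f) ≫ τ X Y Z' =
        τ X Y Z ≫ ((B₂.obj (t.obj X)).obj (t.obj Y)).map (t.map f)) :
    ∃ σ : B₁ ⟶ B₂, ∀ X Y Z, ((σ.app (t.obj X)).app (t.obj Y)).app (t.obj Z) = τ X Y Z := by
  -- The last two variables are extended together, for bifunctors with values in `T ⥤ E`; the first
  -- variable follows.
  have hL (B : C ⥤ C ⥤ C ⥤ E) (h : IsTrirexLinear F' B) :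
      IsBirexLinear F' F' F' ((t ⋙ B).flip ⋙ flipFunctor T C E) :=
    ⟨fun Y => isRexLinear_of_evaluation fun X => h.right (t.obj X) Y,
      fun Z => isRexLinear_of_evaluation fun X => h.middle (t.obj X) Z⟩
  obtain ⟨σ₁, hσ₁⟩ := exists_natTrans₂ ht (hL _ h₁) (hL _ h₂)
    (fun Y Z => { app := fun X => τ X Y Z, naturality := fun _ _ f => nat_left f Y Z })
    (fun f Z => NatTrans.ext (funext fun X => nat_middle X f Z))
    (fun Y _ _ f => NatTrans.ext (funext fun X => nat_right X Y f))
  obtain ⟨σ, hσ⟩ := exists_natTrans ht h₁.rex h₂.rex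
    { app := fun X =>
        { app := fun Y =>
            { app := fun Z => ((σ₁.app Y).app Z).app X
              naturality := fun _ _ f => congrArg (fun k => k.app X) ((σ₁.app Y).naturality f) }
          naturality := fun _ _ f => NatTrans.ext (funext fun Z =>
            congrArg (fun k => (k.app Z).app X) (σ₁.naturality f)) }
      naturality := fun _ _ f => NatTrans.ext (funext fun Y => NatTrans.ext (funext fun Z =>
        ((σ₁.app Y).app Z).naturality f)) }
  exact ⟨σ, fun X Y Z => by rw [hσ]; exact congrArg (fun k => k.app X) (hσ₁ Y Z)⟩

end TransformationsOfTrifunctors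


/-! ### Pentagon and triangle identities by reduction to T -/

section Premonoidal

/-- The axioms of a monoidal category except for the pentagon and the triangle identities. -/
structure IsPremonoidal (C : Type*) [Category* C] [MonoidalCategoryStruct C] : Prop where
  tensorHom_def {X₁ Y₁ X₂ Y₂ : C} (f : X₁ ⟶ Y₁) (g : X₂ ⟶ Y₂) : f ⊗ₘ g = f ▷ X₂ ≫ Y₁ ◁ g
  whiskerLeft_id (X Y : C) : X ◁ 𝟙 Y = 𝟙 (X ⊗ Y)
  whiskerLeft_comp (X : C) {Y₁ Y₂ Y₃ : C} (f : Y₁ ⟶ Y₂) (g : Y₂ ⟶ Y₃) :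
    X ◁ (f ≫ g) = X ◁ f ≫ X ◁ g
  id_whiskerRight (X Y : C) : 𝟙 X ▷ Y = 𝟙 (X ⊗ Y)
  comp_whiskerRight {X₁ X₂ X₃ : C} (f : X₁ ⟶ X₂) (g : X₂ ⟶ X₃) (Y : C) :
    (f ≫ g) ▷ Y = f ▷ Y ≫ g ▷ Y
  whisker_exchange {X₁ X₂ Y₁ Y₂ : C} (f : X₁ ⟶ X₂) (g : Y₁ ⟶ Y₂) :
    X₁ ◁ g ≫ f ▷ Y₂ = f ▷ Y₁ ≫ X₂ ◁ g
  associator_left {X X' : C} (f : X ⟶ X') (Y Z : C) :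
    f ▷ Y ▷ Z ≫ (α_ X' Y Z).hom = (α_ X Y Z).hom ≫ f ▷ (Y ⊗ Z)
  associator_middle (X : C) {Y Y' : C} (f : Y ⟶ Y') (Z : C) :
    (X ◁ f) ▷ Z ≫ (α_ X Y' Z).hom = (α_ X Y Z).hom ≫ X ◁ f ▷ Z
  associator_right (X Y : C) {Z Z' : C} (f : Z ⟶ Z') :
    (X ⊗ Y) ◁ f ≫ (α_ X Y Z').hom = (α_ X Y Z).hom ≫ X ◁ Y ◁ f
  leftUnitor_naturality {X Y : C} (f : X ⟶ Y) : 𝟙_ C ◁ f ≫ (λ_ Y).hom = (λ_ X).hom ≫ f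
  rightUnitor_naturality {X Y : C} (f : X ⟶ Y) : f ▷ 𝟙_ C ≫ (ρ_ Y).hom = (ρ_ X).hom ≫ f

namespace IsPremonoidal

variable {C : Type*} [Category* C] [MonoidalCategoryStruct C] (h : IsPremonoidal C)

include h

theorem whiskerRight_tensorHom {X₁ X₂ X₃ Y₁ Y₂ : C} (f : X₁ ⟶ X₂) (f' : X₂ ⟶ X₃) (g : Y₁ ⟶ Y₂) :
    f ▷ Y₁ ≫ (f' ⊗ₘ g) = (f ≫ f') ⊗ₘ g := by
  rw [h.tensorHom_def, h.tensorHom_def, h.comp_whiskerRight, Category.assoc]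

theorem tensorHom_whiskerRight {X₁ X₂ X₃ Y₁ Y₂ : C} (f : X₁ ⟶ X₂) (f' : X₂ ⟶ X₃) (g : Y₁ ⟶ Y₂) :
    (f ⊗ₘ g) ≫ f' ▷ Y₂ = (f ≫ f') ⊗ₘ g := by
  rw [h.tensorHom_def, h.tensorHom_def, h.comp_whiskerRight, Category.assoc, h.whisker_exchange,
    Category.assoc]

theorem tensorHom_whiskerLeft {X₁ X₂ Y₁ Y₂ Y₃ : C} (f : X₁ ⟶ X₂) (g : Y₁ ⟶ Y₂) (g' : Y₂ ⟶ Y₃) :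
    (f ⊗ₘ g) ≫ X₂ ◁ g' = f ⊗ₘ (g ≫ g') := by
  rw [h.tensorHom_def, h.tensorHom_def, h.whiskerLeft_comp, Category.assoc]

theorem whiskerLeft_tensorHom {X₁ X₂ Y₁ Y₂ Y₃ : C} (f : X₁ ⟶ X₂) (g : Y₁ ⟶ Y₂) (g' : Y₂ ⟶ Y₃) :
    X₁ ◁ g ≫ (f ⊗ₘ g') = f ⊗ₘ (g ≫ g') := by
  rw [h.tensorHom_def, h.tensorHom_def, h.whiskerLeft_comp, reassoc_of% h.whisker_exchange]

theorem associator_naturality {X₁ X₂ X₃ Y₁ Y₂ Y₃ : C} (f₁ : X₁ ⟶ Y₁) (f₂ : X₂ ⟶ Y₂)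
    (f₃ : X₃ ⟶ Y₃) :
    ((f₁ ⊗ₘ f₂) ⊗ₘ f₃) ≫ (α_ Y₁ Y₂ Y₃).hom = (α_ X₁ X₂ X₃).hom ≫ (f₁ ⊗ₘ (f₂ ⊗ₘ f₃)) := by
  simp only [h.tensorHom_def, h.comp_whiskerRight, h.whiskerLeft_comp, Category.assoc]
  rw [h.associator_right, reassoc_of% h.associator_middle, reassoc_of% h.associator_left]

theorem isIso_whiskerLeft (X : C) {Y Z : C} (f : Y ⟶ Z) [IsIso f] : IsIso (X ◁ f) :=
  ⟨X ◁ inv f, by rw [← h.whiskerLeft_comp, IsIso.hom_inv_id, h.whiskerLeft_id],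
    by rw [← h.whiskerLeft_comp, IsIso.inv_hom_id, h.whiskerLeft_id]⟩

theorem epi_tensorHom (epi_left : ∀ (X : C) {Y Z : C} (f : Y ⟶ Z), Epi f → Epi (X ◁ f))
    (epi_right : ∀ {X Y : C} (f : X ⟶ Y) (Z : C), Epi f → Epi (f ▷ Z))
    {X₁ X₂ Y₁ Y₂ : C} (f : X₁ ⟶ X₂) (g : Y₁ ⟶ Y₂) (hf : Epi f) (hg : Epi g) :
    Epi (f ⊗ₘ g) := by
  have := epi_right f Y₁ hf
  have := epi_left X₂ g hg
  rw [h.tensorHom_def]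
  infer_instance

end IsPremonoidal

variable {T : Type*} [Category* T] [MonoidalCategory T] {C : Type*} [Category* C]
  [MonoidalCategoryStruct C]

/-- Isomorphisms that make a functor to a premonoidal category monoidal. -/
structure TensorConstraints (t : T ⥤ C) where
  /-- the constraint for the unit objects -/
  ε : 𝟙_ C ≅ t.obj (𝟙_ T)
  /-- the constraint for tensor products -/
  μ (X Y : T) : t.obj X ⊗ t.obj Y ≅ t.obj (X ⊗ Y)
  natural_left {X X' : T} (f : X ⟶ X') (Y : T) :
    t.map f ▷ t.obj Y ≫ (μ X' Y).hom = (μ X Y).hom ≫ t.map (f ▷ Y)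
  natural_right (X : T) {Y Y' : T} (f : Y ⟶ Y') :
    t.obj X ◁ t.map f ≫ (μ X Y').hom = (μ X Y).hom ≫ t.map (X ◁ f)
  associativity (X Y Z : T) :
    (μ X Y).hom ▷ t.obj Z ≫ (μ (X ⊗ Y) Z).hom ≫ t.map (α_ X Y Z).hom =
      (α_ (t.obj X) (t.obj Y) (t.obj Z)).hom ≫ t.obj X ◁ (μ Y Z).hom ≫ (μ X (Y ⊗ Z)).hom
  left_unitality (X : T) :
    (λ_ (t.obj X)).hom = ε.hom ▷ t.obj X ≫ (μ (𝟙_ T) X).hom ≫ t.map (λ_ X).hom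
  right_unitality (X : T) :
    (ρ_ (t.obj X)).hom = t.obj X ◁ ε.hom ≫ (μ X (𝟙_ T)).hom ≫ t.map (ρ_ X).hom

namespace TensorConstraints

variable {t : T ⥤ C} (K : TensorConstraints t) (h : IsPremonoidal C)

include K h

/-- The isomorphisms `K.μ` carry each associator to the image of one of `T`, so this is the pentagon
of `T` transported along `t`. -/
theorem pentagon_obj (W X Y Z : T) :
    (α_ (t.obj W) (t.obj X) (t.obj Y)).hom ▷ t.obj Z ≫
      (α_ (t.obj W) (t.obj X ⊗ t.obj Y) (t.obj Z)).hom ≫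
        t.obj W ◁ (α_ (t.obj X) (t.obj Y) (t.obj Z)).hom =
      (α_ (t.obj W ⊗ t.obj X) (t.obj Y) (t.obj Z)).hom ≫
        (α_ (t.obj W) (t.obj X) (t.obj Y ⊗ t.obj Z)).hom := by
  have := h.isIso_whiskerLeft (t.obj W) (K.μ X (Y ⊗ Z)).hom
  have := h.isIso_whiskerLeft (t.obj X) (K.μ Y Z).hom
  have := h.isIso_whiskerLeft (t.obj W) (t.obj X ◁ (K.μ Y Z).hom)
  have e₁ : t.obj W ◁ (α_ (t.obj X) (t.obj Y) (t.obj Z)).hom ≫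
      t.obj W ◁ t.obj X ◁ (K.μ Y Z).hom ≫ t.obj W ◁ (K.μ X (Y ⊗ Z)).hom =
        t.obj W ◁ (K.μ X Y).hom ▷ t.obj Z ≫ t.obj W ◁ (K.μ (X ⊗ Y) Z).hom ≫
          t.obj W ◁ t.map (α_ X Y Z).hom := by
    simp only [← h.whiskerLeft_comp, K.associativity]
  have e₂ : (α_ (t.obj W) (t.obj X) (t.obj Y)).hom ▷ t.obj Z ≫
      (t.obj W ◁ (K.μ X Y).hom) ▷ t.obj Z ≫ (K.μ W (X ⊗ Y)).hom ▷ t.obj Z =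
        (K.μ W X).hom ▷ t.obj Y ▷ t.obj Z ≫ (K.μ (W ⊗ X) Y).hom ▷ t.obj Z ≫
          t.map (α_ W X Y).hom ▷ t.obj Z := by
    simp only [← h.comp_whiskerRight, K.associativity]
  rw [← cancel_mono (t.obj W ◁ t.obj X ◁ (K.μ Y Z).hom ≫ t.obj W ◁ (K.μ X (Y ⊗ Z)).hom ≫
    (K.μ W (X ⊗ Y ⊗ Z)).hom)]
  simp only [Category.assoc]
  rw [reassoc_of% e₁, K.natural_right, ← reassoc_of% h.associator_middle,
    ← reassoc_of% K.associativity, reassoc_of% e₂, reassoc_of% K.natural_left,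
    ← reassoc_of% h.associator_right, ← K.associativity, reassoc_of% h.whisker_exchange,
    ← reassoc_of% h.associator_left, ← reassoc_of% K.associativity]
  simp only [← t.map_comp, pentagon]

theorem triangle_obj (X Y : T) :
    (α_ (t.obj X) (𝟙_ C) (t.obj Y)).hom ≫ t.obj X ◁ (λ_ (t.obj Y)).hom =
      (ρ_ (t.obj X)).hom ▷ t.obj Y := by
  rw [← cancel_mono (K.μ X Y).hom, K.left_unitality, K.right_unitality]
  simp only [h.whiskerLeft_comp, h.comp_whiskerRight, Category.assoc]
  rw [K.natural_right, K.natural_left, ← reassoc_of% h.associator_middle,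
    ← reassoc_of% K.associativity, ← t.map_comp, triangle]

variable (cover : ∀ X : C, ∃ (W : T) (p : t.obj W ⟶ X), Epi p)
  (epi_left : ∀ (X : C) {Y Z : C} (f : Y ⟶ Z), Epi f → Epi (X ◁ f))
  (epi_right : ∀ {X Y : C} (f : X ⟶ Y) (Z : C), Epi f → Epi (f ▷ Z))

include cover epi_left epi_right

/-- Both sides are natural, and a tensor product of covers t(W₀) ⟶ W, …, t(Z₀) ⟶ Z is an epimorphism
that can be cancelled. -/
theorem pentagon (W X Y Z : C) :
    (α_ W X Y).hom ▷ Z ≫ (α_ W (X ⊗ Y) Z).hom ≫ W ◁ (α_ X Y Z).hom =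
      (α_ (W ⊗ X) Y Z).hom ≫ (α_ W X (Y ⊗ Z)).hom := by
  obtain ⟨W₀, w, hw⟩ := cover W
  obtain ⟨X₀, x, hx⟩ := cover X
  obtain ⟨Y₀, y, hy⟩ := cover Y
  obtain ⟨Z₀, z, hz⟩ := cover Z
  have := h.epi_tensorHom epi_left epi_right _ z (h.epi_tensorHom epi_left epi_right _ y
    (h.epi_tensorHom epi_left epi_right w x hw hx) hy) hz
  rw [← cancel_epi (((w ⊗ₘ x) ⊗ₘ y) ⊗ₘ z), ← Category.assoc, h.tensorHom_whiskerRight,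
    h.associator_naturality, ← h.whiskerRight_tensorHom, Category.assoc,
    reassoc_of% h.associator_naturality, h.tensorHom_whiskerLeft, h.associator_naturality,
    ← h.whiskerLeft_tensorHom, reassoc_of% K.pentagon_obj h, reassoc_of% h.associator_naturality,
    h.associator_naturality]

theorem triangle (X Y : C) :
    (α_ X (𝟙_ C) Y).hom ≫ X ◁ (λ_ Y).hom = (ρ_ X).hom ▷ Y := by
  obtain ⟨X₀, x, hx⟩ := cover X
  obtain ⟨Y₀, y, hy⟩ := cover Y
  have := h.epi_tensorHom epi_left epi_right _ y (epi_right x (𝟙_ C) hx) hy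
  rw [← cancel_epi ((x ▷ 𝟙_ C) ⊗ₘ y), h.tensorHom_whiskerRight, h.rightUnitor_naturality,
    ← h.whiskerRight_tensorHom, ← K.triangle_obj h, Category.assoc, h.tensorHom_def,
    h.tensorHom_def, Category.assoc, reassoc_of% h.associator_right, ← h.whiskerLeft_comp,
    h.leftUnitor_naturality, h.whiskerLeft_comp, reassoc_of% h.associator_left,
    reassoc_of% h.whisker_exchange]

/-- A premonoidal category that is covered by a monoidal functor is monoidal. -/
abbrev monoidalCategory : MonoidalCategory C where
  tensorHom_def := h.tensorHom_def
  id_tensorHom_id X Y := by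
    rw [h.tensorHom_def, h.whiskerLeft_id, h.id_whiskerRight, Category.comp_id]
  tensorHom_comp_tensorHom f₁ f₂ g₁ g₂ := by
    rw [h.tensorHom_def g₁, ← Category.assoc, h.tensorHom_whiskerRight, h.tensorHom_whiskerLeft]
  whiskerLeft_id := h.whiskerLeft_id
  id_whiskerRight := h.id_whiskerRight
  associator_naturality := h.associator_naturality
  leftUnitor_naturality := h.leftUnitor_naturality
  rightUnitor_naturality := h.rightUnitor_naturality
  pentagon := K.pentagon h cover epi_left epi_right
  triangle := K.triangle h cover epi_left epi_right

/-- The covering functor is monoidal. -/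
abbrev coreMonoidal :
    letI := K.monoidalCategory h cover epi_left epi_right
    t.CoreMonoidal :=
  letI := K.monoidalCategory h cover epi_left epi_right
  { εIso := K.ε
    μIso := K.μ
    μIso_hom_natural_left := K.natural_left
    μIso_hom_natural_right X f := K.natural_right X f
    associativity := K.associativity
    left_unitality := K.left_unitality
    right_unitality := K.right_unitality }

end TensorConstraints

end Premonoidal


/-! ### Hexagon identities and symmetry by reduction to T -/

section Braiding

open Functor.LaxMonoidal

variable {T : Type*} [Category* T] [MonoidalCategory T] [SymmetricCategory T] {C : Type*}
  [Category* C] [MonoidalCategory C]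

/-- Isomorphisms that extend the commutativity constraint of `T` along a monoidal functor. -/
structure BraidingExtension (t : T ⥤ C) [t.Monoidal] where
  /-- the commutativity constraint -/
  braiding (X Y : C) : X ⊗ Y ≅ Y ⊗ X
  naturality_right (X : C) {Y Z : C} (f : Y ⟶ Z) :
    X ◁ f ≫ (braiding X Z).hom = (braiding X Y).hom ≫ f ▷ X
  naturality_left {X Y : C} (f : X ⟶ Y) (Z : C) :
    f ▷ Z ≫ (braiding Y Z).hom = (braiding X Z).hom ≫ Z ◁ f
  braided (X Y : T) :
    μ t X Y ≫ t.map (β_ X Y).hom = (braiding (t.obj X) (t.obj Y)).hom ≫ μ t Y X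

namespace BraidingExtension

variable {t : T ⥤ C} [t.Monoidal] (K : BraidingExtension t)

theorem hexagon_obj (X Y Z : T) :
    (α_ (t.obj X) (t.obj Y) (t.obj Z)).hom ≫ (K.braiding (t.obj X) (t.obj Y ⊗ t.obj Z)).hom ≫
      (α_ (t.obj Y) (t.obj Z) (t.obj X)).hom =
    ((K.braiding (t.obj X) (t.obj Y)).hom ▷ t.obj Z) ≫ (α_ (t.obj Y) (t.obj X) (t.obj Z)).hom ≫
      (t.obj Y ◁ (K.braiding (t.obj X) (t.obj Z)).hom) := by
  have e₁ : t.obj Y ◁ (K.braiding (t.obj X) (t.obj Z)).hom ≫ t.obj Y ◁ μ t Z X =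
      t.obj Y ◁ μ t X Z ≫ t.obj Y ◁ t.map (β_ X Z).hom := by
    simp only [← MonoidalCategory.whiskerLeft_comp, K.braided]
  have e₂ : (K.braiding (t.obj X) (t.obj Y)).hom ▷ t.obj Z ≫ μ t Y X ▷ t.obj Z =
      μ t X Y ▷ t.obj Z ≫ t.map (β_ X Y).hom ▷ t.obj Z := by
    simp only [← MonoidalCategory.comp_whiskerRight, K.braided]
  rw [← cancel_mono (t.obj Y ◁ μ t Z X), ← cancel_mono (μ t Y (Z ⊗ X))]
  simp only [Category.assoc]
  rw [← associativity, ← reassoc_of% K.naturality_right, ← reassoc_of% K.braided,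
    ← associativity_assoc, reassoc_of% e₁, μ_natural_right, ← associativity_assoc,
    reassoc_of% e₂, μ_natural_left_assoc]
  simp only [← t.map_comp, BraidedCategory.hexagon_forward]

variable (cover : ∀ X : C, ∃ (W : T) (p : t.obj W ⟶ X), Epi p)
  (epi_left : ∀ (X : C) {Y Z : C} (f : Y ⟶ Z), Epi f → Epi (X ◁ f))
  (epi_right : ∀ {X Y : C} (f : X ⟶ Y) (Z : C), Epi f → Epi (f ▷ Z))

include cover epi_left epi_right

theorem hexagon (X Y Z : C) :
    (α_ X Y Z).hom ≫ (K.braiding X (Y ⊗ Z)).hom ≫ (α_ Y Z X).hom =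
      ((K.braiding X Y).hom ▷ Z) ≫ (α_ Y X Z).hom ≫ (Y ◁ (K.braiding X Z).hom) := by
  obtain ⟨X₀, x, hx⟩ := cover X
  obtain ⟨Y₀, y, hy⟩ := cover Y
  obtain ⟨Z₀, z, hz⟩ := cover Z
  have := epi_right _ (t.obj Z₀) (epi_right x (t.obj Y₀) hx)
  have := epi_right _ (t.obj Z₀) (epi_left X y hy)
  have := epi_left (X ⊗ Y) z hz
  have e₁ : x ▷ t.obj Y₀ ▷ t.obj Z₀ ≫ (K.braiding X (t.obj Y₀)).hom ▷ t.obj Z₀ =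
      (K.braiding (t.obj X₀) (t.obj Y₀)).hom ▷ t.obj Z₀ ≫ (t.obj Y₀ ◁ x) ▷ t.obj Z₀ := by
    simp only [← MonoidalCategory.comp_whiskerRight, K.naturality_left]
  have e₂ : (X ◁ y) ▷ t.obj Z₀ ≫ (K.braiding X Y).hom ▷ t.obj Z₀ =
      (K.braiding X (t.obj Y₀)).hom ▷ t.obj Z₀ ≫ y ▷ X ▷ t.obj Z₀ := by
    simp only [← MonoidalCategory.comp_whiskerRight, K.naturality_right]
  have e₃ : Y ◁ X ◁ z ≫ Y ◁ (K.braiding X Z).hom =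
      Y ◁ (K.braiding X (t.obj Z₀)).hom ≫ Y ◁ z ▷ X := by
    simp only [← MonoidalCategory.whiskerLeft_comp, K.naturality_right]
  have e₄ : t.obj Y₀ ◁ x ▷ t.obj Z₀ ≫ t.obj Y₀ ◁ (K.braiding X (t.obj Z₀)).hom =
      t.obj Y₀ ◁ (K.braiding (t.obj X₀) (t.obj Z₀)).hom ≫ t.obj Y₀ ◁ t.obj Z₀ ◁ x := by
    simp only [← MonoidalCategory.whiskerLeft_comp, K.naturality_left]
  rw [← cancel_epi ((X ⊗ Y) ◁ z), ← cancel_epi ((X ◁ y) ▷ t.obj Z₀),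
    ← cancel_epi (x ▷ t.obj Y₀ ▷ t.obj Z₀)]
  -- Both sides are brought to this middle term by sliding `x`, `y`, `z` past the constraints;
  -- `hexagon_obj` is then applied at the objects of the covers.
  trans (α_ (t.obj X₀) (t.obj Y₀) (t.obj Z₀)).hom ≫
    (K.braiding (t.obj X₀) (t.obj Y₀ ⊗ t.obj Z₀)).hom ≫ (α_ _ _ _).hom ≫
      t.obj Y₀ ◁ t.obj Z₀ ◁ x ≫ y ▷ (t.obj Z₀ ⊗ X) ≫ Y ◁ z ▷ X
  · rw [associator_naturality_right_assoc, associator_naturality_middle_assoc,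
      associator_naturality_left_assoc, reassoc_of% K.naturality_right,
      reassoc_of% K.naturality_right, reassoc_of% K.naturality_left,
      associator_naturality_middle, associator_naturality_left_assoc,
      associator_naturality_right_assoc]
  · rw [reassoc_of% K.hexagon_obj, whisker_exchange_assoc (K.braiding X Y).hom z, reassoc_of% e₂, reassoc_of% e₁,
      associator_naturality_right_assoc, e₃, associator_naturality_left_assoc,
      associator_naturality_middle_assoc, ← whisker_exchange_assoc y (K.braiding X (t.obj Z₀)).hom,
      reassoc_of% e₄]

theorem symmetry (X Y : C) : (K.braiding X Y).hom ≫ (K.braiding Y X).hom = 𝟙 (X ⊗ Y) := by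
  obtain ⟨X₀, x, hx⟩ := cover X
  obtain ⟨Y₀, y, hy⟩ := cover Y
  have := epi_right x (t.obj Y₀) hx
  have := epi_left X y hy
  have e : (K.braiding (t.obj X₀) (t.obj Y₀)).hom ≫ (K.braiding (t.obj Y₀) (t.obj X₀)).hom =
      𝟙 _ := by
    rw [← cancel_mono (μ t X₀ Y₀), Category.assoc, ← K.braided, ← reassoc_of% K.braided,
      ← t.map_comp, SymmetricCategory.symmetry, t.map_id, Category.comp_id, Category.id_comp]
  rw [← cancel_epi (X ◁ y), ← cancel_epi (x ▷ t.obj Y₀), reassoc_of% K.naturality_right,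
    K.naturality_left, reassoc_of% K.naturality_left, reassoc_of% K.naturality_right,
    reassoc_of% e, Category.comp_id]

theorem braiding_hom (X Y : C) : (K.braiding X Y).hom = (K.braiding Y X).inv := by
  rw [← cancel_mono (K.braiding Y X).hom, K.symmetry cover epi_left epi_right, Iso.inv_hom_id]

/-- By symmetry the constraint for swapped objects is the inverse, so this is the inverse of the
first hexagon for `Z`, `X`, `Y`. -/
theorem hexagon_reverse (X Y Z : C) :
    (α_ X Y Z).inv ≫ (K.braiding (X ⊗ Y) Z).hom ≫ (α_ Z X Y).inv =
      (X ◁ (K.braiding Y Z).hom) ≫ (α_ X Z Y).inv ≫ ((K.braiding X Z).hom ▷ Y) := by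
  have e := K.braiding_hom cover epi_left epi_right
  have h : (α_ Z X Y ≪≫ K.braiding Z (X ⊗ Y) ≪≫ α_ X Y Z) =
      whiskerRightIso (K.braiding Z X) Y ≪≫ α_ X Z Y ≪≫ whiskerLeftIso X (K.braiding Z Y) :=
    Iso.ext (K.hexagon cover epi_left epi_right Z X Y)
  simpa [e] using congrArg Iso.inv h

/-- A monoidal category to which the commutativity constraint extends is symmetric. -/
abbrev symmetricCategory : SymmetricCategory C where
  braiding := K.braiding
  braiding_naturality_right := K.naturality_right
  braiding_naturality_left := K.naturality_left
  hexagon_forward := K.hexagon cover epi_left epi_right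
  hexagon_reverse := K.hexagon_reverse cover epi_left epi_right
  symmetry := K.symmetry cover epi_left epi_right

end BraidingExtension

end Braiding


/-! ### Monoidal data from a bifunctor -/

section TensorStruct

variable {C : Type*} [Category* C] (B : C ⥤ C ⥤ C) (U : C)
  (a : bifunctorComp₁₂ B B ≅ bifunctorComp₂₃ B B) (l : B.obj U ≅ 𝟭 C) (r : B.flip.obj U ≅ 𝟭 C)

/-- The monoidal structure attached to a bifunctor and natural constraints. -/
abbrev tensorStruct : MonoidalCategoryStruct C where
  tensorObj X Y := (B.obj X).obj Y
  whiskerLeft X _ _ f := (B.obj X).map f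
  whiskerRight f Y := (B.map f).app Y
  tensorUnit := U
  associator X Y Z := ((a.app X).app Y).app Z
  leftUnitor X := l.app X
  rightUnitor X := r.app X

theorem isPremonoidal_tensorStruct :
    letI := tensorStruct B U a l r
    IsPremonoidal C :=
  letI := tensorStruct B U a l r
  { tensorHom_def := fun _ _ => rfl
    whiskerLeft_id := fun X Y => (B.obj X).map_id Y
    whiskerLeft_comp := fun X _ _ _ f g => (B.obj X).map_comp f g
    id_whiskerRight := fun X Y => (B.flip.obj Y).map_id X
    comp_whiskerRight := fun f g Y => (B.flip.obj Y).map_comp f g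
    whisker_exchange := fun f g => (B.map f).naturality g
    associator_left := fun f Y Z => congrArg (fun k => (k.app Y).app Z) (a.hom.naturality f)
    associator_middle := fun X _ _ f Z => congrArg (fun k => k.app Z) ((a.hom.app X).naturality f)
    associator_right := fun X Y _ _ f => ((a.hom.app X).app Y).naturality f
    leftUnitor_naturality := fun f => l.hom.naturality f
    rightUnitor_naturality := fun f => r.hom.naturality f }

end TensorStruct

/-! ### Extension of the associativity, unit and commutativity constraints -/

section Constraints

variable {F F' : Type*} [Field F] [Field F'] [Algebra F F'] {T : Type u}
  [Category.{v} T] [Abelian T] [Linear F T] {C : Type*} [Category* C] [Abelian C]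
  [Linear F' C] {t : T ⥤ C} (ht : IsScalarExtension F F' t) [MonoidalCategory T]
  {B : C ⥤ C ⥤ C} (hB : IsBirexLinear F' F' F' B)

theorem isTrirexLinear₁₂ (h : IsBirexLinear F' F' F' B) :
    IsTrirexLinear F' (bifunctorComp₁₂ B B) :=
  ⟨fun Y Z => (h.left Y).comp (h.left Z), fun X Z => (h.right X).comp (h.left Z),
    fun X Y => h.right ((B.obj X).obj Y)⟩

theorem isTrirexLinear₂₃ (h : IsBirexLinear F' F' F' B) :
    IsTrirexLinear F' (bifunctorComp₂₃ B B) :=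
  ⟨fun Y Z => h.left ((B.obj Y).obj Z), fun X Z => (h.left Z).comp (h.right X),
    fun X Y => (h.right Y).comp (h.right X)⟩

theorem isRexLinear_id : IsRexLinear F' F' (𝟭 C) where
  additive := inferInstance
  map_smul _ _ := rfl
  rightExact := inferInstance

/-- Naturality of a morphism that is conjugate to a natural morphism. -/
theorem conj_naturality {A A' P P' Q Q' D D' : C} {p : A ≅ P} {p' : A' ≅ P'} {q : D ≅ Q}
    {q' : D' ≅ Q'} {c : P ≅ Q} {c' : P' ≅ Q'} {f : A ⟶ A'} {g : P ⟶ P'} {g' : Q ⟶ Q'}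
    {f' : D ⟶ D'} (hp : f ≫ p'.hom = p.hom ≫ g) (hq : f' ≫ q'.hom = q.hom ≫ g')
    (hc : g ≫ c'.hom = c.hom ≫ g') :
    f ≫ (p' ≪≫ c' ≪≫ q'.symm).hom = (p ≪≫ c ≪≫ q.symm).hom ≫ f' := by
  simp [reassoc_of% hp, reassoc_of% hc, ← cancel_mono q'.hom, hq]

include ht hB in
theorem exists_associator_of_natural
    (τ : ∀ X Y Z, (B.obj ((B.obj (t.obj X)).obj (t.obj Y))).obj (t.obj Z) ≅
      (B.obj (t.obj X)).obj ((B.obj (t.obj Y)).obj (t.obj Z)))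
    (nat_left : ∀ {X X' : T} (f : X ⟶ X') (Y Z : T),
      (B.map ((B.map (t.map f)).app (t.obj Y))).app (t.obj Z) ≫ (τ X' Y Z).hom =
        (τ X Y Z).hom ≫ (B.map (t.map f)).app ((B.obj (t.obj Y)).obj (t.obj Z)))
    (nat_middle : ∀ (X : T) {Y Y' : T} (f : Y ⟶ Y') (Z : T),
      (B.map ((B.obj (t.obj X)).map (t.map f))).app (t.obj Z) ≫ (τ X Y' Z).hom =
        (τ X Y Z).hom ≫ (B.obj (t.obj X)).map ((B.map (t.map f)).app (t.obj Z)))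
    (nat_right : ∀ (X Y : T) {Z Z' : T} (f : Z ⟶ Z'),
      (B.obj ((B.obj (t.obj X)).obj (t.obj Y))).map (t.map f) ≫ (τ X Y Z').hom =
        (τ X Y Z).hom ≫ (B.obj (t.obj X)).map ((B.obj (t.obj Y)).map (t.map f))) :
    ∃ a : bifunctorComp₁₂ B B ≅ bifunctorComp₂₃ B B, ∀ X Y Z : T,
      ((a.hom.app (t.obj X)).app (t.obj Y)).app (t.obj Z) = (τ X Y Z).hom := by
  obtain ⟨a, ha⟩ := exists_natTrans₃ ht (isTrirexLinear₁₂ hB) (isTrirexLinear₂₃ hB)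
    (fun X Y Z => (τ X Y Z).hom) nat_left nat_middle nat_right
  have := isIso_of_isIso_app₃ ht (isTrirexLinear₁₂ hB) (isTrirexLinear₂₃ hB) a fun X Y Z => by
    rw [ha]
    exact (τ X Y Z).isIso_hom
  exact ⟨asIso a, ha⟩

variable (m : ∀ X Y, (B.obj (t.obj X)).obj (t.obj Y) ≅ t.obj (X ⊗ Y))
  (m_left : ∀ {X X' : T} (f : X ⟶ X') (Y : T), (B.map (t.map f)).app (t.obj Y) ≫ (m X' Y).hom =
    (m X Y).hom ≫ t.map (f ▷ Y))
  (m_right : ∀ (X : T) {Y Y' : T} (f : Y ⟶ Y'), (B.obj (t.obj X)).map (t.map f) ≫ (m X Y').hom =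
    (m X Y).hom ≫ t.map (X ◁ f))

include ht hB m_left m_right in
-- Compatibility with `m` forces the associator on objects of the form t(X): it is `t.map (α_ X Y
-- Z).hom` conjugated by the two iterated comparison isomorphisms, `p` and `q` below. It is natural
-- in `T` and therefore extends.
theorem exists_associator : ∃ a : bifunctorComp₁₂ B B ≅ bifunctorComp₂₃ B B, ∀ X Y Z : T,
    (B.map (m X Y).hom).app (t.obj Z) ≫ (m (X ⊗ Y) Z).hom ≫ t.map (α_ X Y Z).hom =
      ((a.hom.app (t.obj X)).app (t.obj Y)).app (t.obj Z) ≫ (B.obj (t.obj X)).map (m Y Z).hom ≫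
        (m X (Y ⊗ Z)).hom := by
  let p (X Y Z : T) : (B.obj ((B.obj (t.obj X)).obj (t.obj Y))).obj (t.obj Z) ≅
      t.obj ((X ⊗ Y) ⊗ Z) := (B.mapIso (m X Y)).app (t.obj Z) ≪≫ m (X ⊗ Y) Z
  let q (X Y Z : T) : (B.obj (t.obj X)).obj ((B.obj (t.obj Y)).obj (t.obj Z)) ≅
      t.obj (X ⊗ Y ⊗ Z) := (B.obj (t.obj X)).mapIso (m Y Z) ≪≫ m X (Y ⊗ Z)
  obtain ⟨a, ha⟩ := exists_associator_of_natural ht hB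
    (fun X Y Z => p X Y Z ≪≫ t.mapIso (α_ X Y Z) ≪≫ (q X Y Z).symm)
    (fun {X X'} f Y Z => conj_naturality (g := t.map (f ▷ Y ▷ Z)) (g' := t.map (f ▷ (Y ⊗ Z)))
      (by
        simp only [p, Iso.trans_hom, Iso.app_hom, Functor.mapIso_hom, ← NatTrans.comp_app_assoc,
          ← Functor.map_comp, m_left]
        simp [m_left])
      (by
        simp only [q, Iso.trans_hom, Functor.mapIso_hom, Category.assoc]
        rw [← NatTrans.naturality_assoc, m_left])
      (by simp [← Functor.map_comp]))
    (fun X Y Y' f Z => conj_naturality (g := t.map ((X ◁ f) ▷ Z)) (g' := t.map (X ◁ f ▷ Z))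
      (by
        simp only [p, Iso.trans_hom, Iso.app_hom, Functor.mapIso_hom, ← NatTrans.comp_app_assoc,
          ← Functor.map_comp, m_right]
        simp [m_left])
      (by simp [q, m_right, m_left, ← Functor.map_comp_assoc]) 
      (by simp [← Functor.map_comp]))
    (fun X Y Z Z' f => conj_naturality (g := t.map ((X ⊗ Y) ◁ f)) (g' := t.map (X ◁ Y ◁ f))
      (by simp [p, m_right]) 
      (by simp [q, m_right, ← Functor.map_comp_assoc])
      (by simp [← Functor.map_comp]))
  refine ⟨a, fun X Y Z => ?_⟩
  have e : (p X Y Z).hom ≫ t.map (α_ X Y Z).hom =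
      (p X Y Z ≪≫ t.mapIso (α_ X Y Z) ≪≫ (q X Y Z).symm).hom ≫ (q X Y Z).hom := by
    simp
  rw [← ha] at e
  exact (Category.assoc _ _ _).symm.trans e

include ht hB m_right in
theorem exists_leftUnitor : ∃ l : B.obj (t.obj (𝟙_ T)) ≅ 𝟭 C, ∀ X : T,
    l.hom.app (t.obj X) = (m (𝟙_ T) X).hom ≫ t.map (λ_ X).hom := by
  obtain ⟨l, hl⟩ := exists_natTrans ht (hB.right (t.obj (𝟙_ T))) isRexLinear_id
    { app := fun X => (m (𝟙_ T) X).hom ≫ t.map (λ_ X).hom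
      naturality := fun X Y f => by
        change (B.obj (t.obj (𝟙_ T))).map (t.map f) ≫ _ = (_ ≫ _) ≫ t.map f
        rw [reassoc_of% m_right, ← t.map_comp, leftUnitor_naturality, t.map_comp, Category.assoc] }
  have := isIso_of_isIso_app ht (hB.right (t.obj (𝟙_ T))) isRexLinear_id l fun X => by
    rw [hl]
    exact ((m (𝟙_ T) X) ≪≫ t.mapIso (λ_ X)).isIso_hom
  exact ⟨asIso l, hl⟩

include ht hB m_left in
theorem exists_rightUnitor : ∃ r : B.flip.obj (t.obj (𝟙_ T)) ≅ 𝟭 C, ∀ X : T,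
    r.hom.app (t.obj X) = (m X (𝟙_ T)).hom ≫ t.map (ρ_ X).hom := by
  obtain ⟨r, hr⟩ := exists_natTrans ht (hB.left (t.obj (𝟙_ T))) isRexLinear_id
    { app := fun X => (m X (𝟙_ T)).hom ≫ t.map (ρ_ X).hom
      naturality := fun X Y f => by
        change (B.map (t.map f)).app (t.obj (𝟙_ T)) ≫ _ = (_ ≫ _) ≫ t.map f
        rw [reassoc_of% m_left, ← t.map_comp, rightUnitor_naturality, t.map_comp, Category.assoc] }
  have := isIso_of_isIso_app ht (hB.left (t.obj (𝟙_ T))) isRexLinear_id r fun X => by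
    rw [hr]
    exact ((m X (𝟙_ T)) ≪≫ t.mapIso (ρ_ X)).isIso_hom
  exact ⟨asIso r, hr⟩

include ht hB m_left m_right in
theorem exists_braiding [BraidedCategory T] : ∃ b : B ≅ B.flip, ∀ X Y : T,
    (m X Y).hom ≫ t.map (β_ X Y).hom = (b.hom.app (t.obj X)).app (t.obj Y) ≫ (m Y X).hom := by
  let τ (X Y : T) : (B.obj (t.obj X)).obj (t.obj Y) ≅ (B.obj (t.obj Y)).obj (t.obj X) :=
    m X Y ≪≫ t.mapIso (β_ X Y) ≪≫ (m Y X).symm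
  obtain ⟨b, hb⟩ := exists_natTrans₂ ht hB hB.flip (fun X Y => (τ X Y).hom)
    (fun {X X'} f Y => conj_naturality (m_left f Y) (m_right Y f) (by simp [← Functor.map_comp]))
    (fun X _ _ f => conj_naturality (m_right X f) (m_left f X) (by simp [← Functor.map_comp]))
  have := isIso_of_isIso_app₂ ht hB hB.flip b fun X Y => by
    rw [hb]
    exact (τ X Y).isIso_hom
  refine ⟨asIso b, fun X Y => ?_⟩
  have e : (m X Y).hom ≫ t.map (β_ X Y).hom = (τ X Y).hom ≫ (m Y X).hom := by
    simp [τ]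
  rw [← hb] at e
  exact e

end Constraints

/-! ### The symmetric monoidal structure on the scalar extension -/

section TensorProduct

variable {F F' : Type*} [Field F] [Field F'] [Algebra F F'] {T : Type u}
  [Category.{v} T] [Abelian T] [Linear F T] {C : Type*} [Category* C] [Abelian C]
  [Linear F' C] {t : T ⥤ C} (ht : IsScalarExtension F F' t) [MonoidalCategory T]
  [SymmetricCategory T]

include ht in
/-- The tensor product extends to the scalar extension. -/
theorem exists_symmetricCategory (hT : IsBirexLinear F F F (curriedTensor T)) :
    ∃ (_ : MonoidalCategory C) (_ : SymmetricCategory C) (_ : t.Braided),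
      IsBirexLinear F' F' F' (curriedTensor C) := by
  have hB₀ : IsBirexLinear F F F' (curriedTensor T ⋙ (Functor.whiskeringRight T T C).obj t) :=
    ⟨fun X => (hT.right X).comp ht.rex, fun Y => (hT.left Y).comp ht.rex⟩
  obtain ⟨B, hB, m, m_left, m_right⟩ := exists_extension₂ ht hB₀
  obtain ⟨a, ha⟩ := exists_associator ht hB m m_left m_right
  obtain ⟨l, hl⟩ := exists_leftUnitor ht hB m m_right
  obtain ⟨r, hr⟩ := exists_rightUnitor ht hB m m_left
  obtain ⟨b, hb⟩ := exists_braiding ht hB m m_left m_right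
  have epi_left (X : C) {Y Z : C} (f : Y ⟶ Z) (hf : Epi f) : Epi ((B.obj X).map f) :=
    (hB.right X).map_epi f
  have epi_right {X Y : C} (f : X ⟶ Y) (Z : C) (hf : Epi f) : Epi ((B.map f).app Z) :=
    (hB.left Z).map_epi f
  let S : MonoidalCategoryStruct C := tensorStruct B (t.obj (𝟙_ T)) a l r
  have hS : IsPremonoidal C := isPremonoidal_tensorStruct B (t.obj (𝟙_ T)) a l r
  let K : TensorConstraints t :=
    -- The unit object was chosen to be `t.obj (𝟙_ T)` itself.
    { ε := Iso.refl _
      μ := m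
      natural_left := m_left
      natural_right := m_right
      associativity := ha
      left_unitality := fun X => (hl X).trans ((Category.id_comp _).symm.trans
        (congrArg (· ≫ _) (hS.id_whiskerRight _ _).symm))
      right_unitality := fun X => (hr X).trans ((Category.id_comp _).symm.trans
        (congrArg (· ≫ _) (hS.whiskerLeft_id _ _).symm)) }
  let _ : MonoidalCategory C := K.monoidalCategory hS ht.exists_cover epi_left epi_right
  let _ : t.Monoidal := (K.coreMonoidal hS ht.exists_cover epi_left epi_right).toMonoidal
  let L : BraidingExtension t :=
    { braiding := fun X Y => (b.app X).app Y
      naturality_right := fun X _ _ f => (b.hom.app X).naturality f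
      naturality_left := fun f Z => congrArg (fun k => k.app Z) (b.hom.naturality f)
      braided := hb }
  let _ : SymmetricCategory C := L.symmetricCategory ht.exists_cover epi_left epi_right
  exact ⟨inferInstance, inferInstance, { braided := L.braided }, hB⟩

end TensorProduct


/-! ### The concrete functor t is a scalar extension -/

section MainInstance

variable {F : Type w} {F' : Type v} [Field F] [Field F'] [Algebra F F'] {T : Type u}
  [Category.{v} T] [Abelian T] [Linear F T]

/-- The functor `t` has the characteristic properties of scalar extension. -/
theorem isScalarExtension_toScalarExt (hfin : FFinite F T)
    (h : ∀ X : T, HasFiniteLength (IndModule F F' T) ((scalarExtFunctor F T F').obj X)) :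
    IsScalarExtension F F' (toScalarExt h) where
  rex :=
    { additive := ⟨fun {X Y f g} => ObjectProperty.hom_ext _ (scalarExtFunctor F T F').map_add⟩
      map_smul := fun c f => ObjectProperty.hom_ext _ (scalarExtFunctor_map_smul c f)
      rightExact := by
        have : PreservesFiniteColimits
            (toScalarExt h ⋙ (HasFiniteLength (IndModule F F' T)).ι) :=
          inferInstanceAs (PreservesFiniteColimits (scalarExtFunctor F T F'))
        have : ReflectsFiniteColimits (HasFiniteLength (IndModule F F' T)).ι :=
          { reflects := fun _ => inferInstance }
        exact preservesFiniteColimits_of_reflects_of_preserves _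
          (HasFiniteLength (IndModule F F' T)).ι }
  exists_basis W X := by
    let e := Module.Basis.ofVectorSpace F (W ⟶ X)
    let l : ((scalarExtFunctor F T F').obj W ⟶ (scalarExtFunctor F T F').obj X) ≃ₗ[F']
        ((toScalarExt h).obj W ⟶ (toScalarExt h).obj X) :=
      { toFun := fun f => ObjectProperty.homMk f
        invFun := fun f => f.hom
        map_add' := fun _ _ => rfl
        map_smul' := fun _ _ => rfl
        left_inv := fun _ => rfl
        right_inv := fun _ => rfl }
    exact ⟨_, e, (homBasis e).map l, fun k =>
      ObjectProperty.hom_ext _ (homBasis_apply (F' := F') e k)⟩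
  exists_cover X := by
    obtain ⟨W, p, _⟩ := exists_epi_scalarExt X.property
    let p' : (toScalarExt h).obj W ⟶ X := ObjectProperty.homMk p
    have : Epi ((HasFiniteLength (IndModule F F' T)).ι.map p') := inferInstanceAs (Epi p)
    exact ⟨W, p', (HasFiniteLength (IndModule F F' T)).ι.epi_of_epi_map this⟩
  exists_lift {X Y} q _ W f := by
    -- Lifting takes place among all modules, so `q` must remain an epimorphism outside the
    -- subcategory.
    have := (HasFiniteLength (IndModule F F' T)).preservesEpimorphisms_ι_of_isNormalMonoCategory
    have : Epi q.hom := inferInstanceAs (Epi ((HasFiniteLength (IndModule F F' T)).ι.map q))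
    obtain ⟨V, p, hp, g, hg⟩ := exists_lift_scalarExt q.hom (hfin.hasFiniteLength W) f.hom
    exact ⟨V, p, hp, ObjectProperty.homMk g, ObjectProperty.hom_ext _ hg⟩

end MainInstance

/-! ### Endomorphisms of the unit object -/

section Unit

theorem bijective_algebraMap_end_of_iso {R C : Type*} [Field R] [Category* C] [Preadditive C]
    [Linear R C] {X Y : C} (e : X ≅ Y) (h : Function.Bijective (algebraMap R (End Y))) :
    Function.Bijective (algebraMap R (End X)) := by
  have key (c : R) : algebraMap R (End X) c = e.hom ≫ algebraMap R (End Y) c ≫ e.inv := by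
    rw [Algebra.algebraMap_eq_smul_one, Algebra.algebraMap_eq_smul_one]
    change c • 𝟙 X = e.hom ≫ (c • 𝟙 Y : Y ⟶ Y) ≫ e.inv
    simp
  constructor
  · intro a b hab
    rw [key, key] at hab
    exact h.1 ((cancel_mono e.inv).1 ((cancel_epi e.hom).1 hab))
  · intro f
    obtain ⟨c, hc⟩ := h.2 (e.inv ≫ f ≫ e.hom)
    exact ⟨c, by rw [key, hc]; simp⟩

variable {F F' : Type*} [Field F] [Field F'] [Algebra F F'] {T : Type u}
  [Category.{v} T] [Abelian T] [Linear F T] {C : Type*} [Category* C] [Abelian C]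
  [Linear F' C] {t : T ⥤ C} (ht : IsScalarExtension F F' t)

include ht in
-- End(tX) is spanned over `F'` by the `t(f)`, which are multiples of the identity when End(X) = F.
-- The identity is nonzero because the basis is nonempty.
theorem IsScalarExtension.bijective_algebraMap_end {X : T}
    (h : Function.Bijective (algebraMap F (End X))) :
    Function.Bijective (algebraMap F' (End (t.obj X))) := by
  constructor
  · obtain ⟨κ, e, b, hb⟩ := ht.exists_basis X X
    have : Nontrivial (X ⟶ X) := h.1.nontrivial
    obtain ⟨k⟩ := e.index_nonempty
    have h0 : (𝟙 (t.obj X) : t.obj X ⟶ t.obj X) ≠ 0 := fun h0 => b.ne_zero k (by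
      rw [← Category.comp_id (b k), h0, comp_zero])
    rw [injective_iff_map_eq_zero]
    intro c hc
    rw [Algebra.algebraMap_eq_smul_one] at hc
    exact (smul_eq_zero.1 hc).resolve_right h0
  · intro f
    let S : Submodule F' (t.obj X ⟶ t.obj X) := Submodule.span F' {𝟙 _}
    -- The quotient by the line of the identity vanishes on all `t(f)`, hence everywhere.
    have hS : S.mkQ = 0 := ht.linearMap_ext fun g => by
      obtain ⟨c, rfl⟩ := h.2 g
      rw [LinearMap.zero_apply, Submodule.mkQ_apply, Submodule.Quotient.mk_eq_zero,
        Algebra.algebraMap_eq_smul_one, ht.rex.map_smul]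
      exact Submodule.smul_mem _ _ (Submodule.subset_span (t.map_id X))
    have hf : f ∈ S := by
      rw [← Submodule.Quotient.mk_eq_zero, ← Submodule.mkQ_apply, hS, LinearMap.zero_apply]
    obtain ⟨c, hc⟩ := Submodule.mem_span_singleton.1 hf
    exact ⟨c, by rw [Algebra.algebraMap_eq_smul_one]; exact hc⟩

end Unit

/-! ### Curried and uncurried bilinear functors -/

section Bilinear

variable {R : Type w} [Field R] {C : Type u} [Category.{v} C] [Preadditive C] [Linear R C]

theorem isBirexLinear_curry_iff {M : C × C ⥤ C} :
    IsBirexLinear R R R (Functor.curry.obj M) ↔ IsRightExactBilinear R M := by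
  have hr (X : C) : (Functor.curry.obj M).obj X = Prod.sectR X C ⋙ M := rfl
  have hl (Y : C) : (Functor.curry.obj M).flip.obj Y = Prod.sectL C Y ⋙ M := rfl
  constructor
  · rintro ⟨h₁, h₂⟩
    simp only [hr, hl] at h₁ h₂
    exact ⟨fun Y => (h₂ Y).additive, fun X => (h₁ X).additive,
      fun Y => ⟨fun f c => (h₂ Y).map_smul c f⟩, fun X => ⟨fun f c => (h₁ X).map_smul c f⟩,
      fun Y => (h₂ Y).rightExact, fun X => (h₁ X).rightExact⟩
  · rintro ⟨a₁, a₂, l₁, l₂, r₁, r₂⟩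
    exact ⟨fun X => ⟨a₂ X, fun c f => (l₂ X).map_smul f c, r₂ X⟩,
      fun Y => ⟨a₁ Y, fun c f => (l₁ Y).map_smul f c, r₁ Y⟩⟩

/-- The curried form of the tensor product. -/
def curryTensorIso (C : Type*) [Category* C] [MonoidalCategory C] :
    Functor.curry.obj (tensor C) ≅ curriedTensor C :=
  NatIso.ofComponents (fun X => NatIso.ofComponents (fun Y => Iso.refl _))

theorem isBirexLinear_curriedTensor_iff [MonoidalCategory C] :
    IsBirexLinear R R R (curriedTensor C) ↔ IsRightExactBilinear R (tensor C) :=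
  (Iff.intro (fun h => h.of_iso (curryTensorIso C).symm)
    fun h => h.of_iso (curryTensorIso C)).trans isBirexLinear_curry_iff

end Bilinear

/-! ### The universal property for bilinear functors -/

section UniversalProperty

variable {F : Type*} {F' : Type w} [Field F] [Field F'] [Algebra F F'] {T : Type*}
  [Category.{v} T] [Abelian T] [Linear F T] {C : Type u} [Category.{v} C] [Abelian C]
  [Linear F' C] {t : T ⥤ C} (ht : IsScalarExtension F F' t)

include ht in
/-- The universal property of scalar extension for bilinear functors. -/
theorem existsUnique_iso {N M : C × C ⥤ C} (hN : IsRightExactBilinear F' N)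
    (hM : IsRightExactBilinear F' M) (τ : t.prod t ⋙ N ≅ t.prod t ⋙ M) :
    ∃! e : N ≅ M, ∀ X Y : T, e.hom.app (t.obj X, t.obj Y) = τ.hom.app (X, Y) := by
  have hN' := isBirexLinear_curry_iff.2 hN
  have hM' := isBirexLinear_curry_iff.2 hM
  obtain ⟨σ, hσ⟩ := exists_natTrans₂ ht hN' hM' (fun X Y => τ.hom.app (X, Y))
    (fun {X X'} f Y => by
      have := τ.hom.naturality (X := (X, Y)) (Y := (X', Y)) (Prod.mkHom f (𝟙 Y))
      dsimp at this ⊢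
      rwa [t.map_id] at this)
    (fun X {Y Y'} f => by
      have := τ.hom.naturality (X := (X, Y)) (Y := (X, Y')) (Prod.mkHom (𝟙 X) f)
      dsimp at this ⊢
      rwa [t.map_id] at this)
  have := isIso_of_isIso_app₂ ht hN' hM' σ fun X Y => by
    rw [hσ]
    exact (τ.app (X, Y)).isIso_hom
  refine ⟨Functor.curry.preimageIso (asIso σ), fun X Y => ?_, fun e he => ?_⟩
  · rw [← hσ]
    have := Functor.curry.map_preimage σ
    exact congrArg (fun k => (k.app (t.obj X)).app (t.obj Y)) this
  · apply Iso.ext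
    apply Functor.curry.map_injective
    refine natTrans_ext₂ ht hN' fun X Y => (he X Y).trans ?_
    rw [← hσ]
    exact congrArg (fun k => (k.app (t.obj X)).app (t.obj Y)) (Functor.curry.map_preimage σ).symm

end UniversalProperty

end ScalarExtension

/-! ### The main theorem -/

theorem mainTheorem6 {F : Type w} {F' : Type v} [Field F] [Field F'] [Algebra F F']
    {T : Type u} [Category.{v} T] [Abelian T] [Linear F T]
    [MonoidalCategory T] [SymmetricCategory T]
    (hT : AbelianTensorCategory F T) (hfin : FFinite F T) :
    ∃ (h : ∀ X : T, HasFiniteLength (IndModule F F' T) ((scalarExtFunctor F T F').obj X))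
      (_ : MonoidalCategory (ScalarExt F F' T)) (_ : SymmetricCategory (ScalarExt F F' T))
      (_ : (toScalarExt h).Braided),
      AbelianTensorCategory F' (ScalarExt F F' T) ∧
      ∀ (M : ScalarExt F F' T × ScalarExt F F' T ⥤ ScalarExt F F' T)
        (_ : IsRightExactBilinear F' M)
        (α : tensor T ⋙ toScalarExt h ≅ (toScalarExt h).prod (toScalarExt h) ⋙ M),
        ∃! e : tensor (ScalarExt F F' T) ≅ M, ∀ X Y : T,
          Functor.LaxMonoidal.μ (toScalarExt h) X Y ≫ α.hom.app (X, Y) =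
            e.hom.app ((toScalarExt h).obj X, (toScalarExt h).obj Y) := by
  have h : ∀ X : T, HasFiniteLength (IndModule F F' T) ((scalarExtFunctor F T F').obj X) :=
    hasFiniteLength_scalarExt hfin
  have ht := isScalarExtension_toScalarExt hfin h
  obtain ⟨mc, sc, bt, hC⟩ := exists_symmetricCategory ht
    (isBirexLinear_curriedTensor_iff.2 hT.bilinear)
  have hC' := isBirexLinear_curriedTensor_iff.1 hC
  refine ⟨h, mc, sc, bt, ⟨⟨inferInstance, rfl⟩, hC', ?_⟩, fun M hM α => ?_⟩
  · exact bijective_algebraMap_end_of_iso (Functor.Monoidal.εIso (toScalarExt h))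
      (ht.bijective_algebraMap_end hT.unit)
  -- The isomorphism to extend is μ followed by α, a transformation between the restrictions of ⊗'
  -- and `M` to T × T.
  · obtain ⟨e, he, hu⟩ := existsUnique_iso ht hC' hM
      (Functor.Monoidal.μNatIso (toScalarExt h) ≪≫ α)
    exact ⟨e, fun X Y => (he X Y).symm, fun e' he' => hu e' fun X Y => (he' X Y).symm⟩
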